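/- Theorem 4.5. Let $n$ be a natural number, $\sigma,\rho,m>0$, let $\pm$ be a choice of sign with $\sigma\pm\rho\neq0$, and put $\epsilon=\sigma/(\sigma\pm\rho)$, $D=m\rho^2$. (A ball in $\mathbb R^n$ of mass $m$ and radius $\rho$ rolls without slipping and twisting over a fixed sphere of radius $\sigma$.) On $so(n)$ use $\langle X,Y\rangle=-\tfrac12\operatorname{tr}(XY)$, and write $x\wedge y=xy^T-yx^T$ for $x,y\in\mathbb R^n$. Let $\mathbb I:so(n)\to so(n)$ be an arbitrary inertia operator, that is, symmetric and positive definite with respect to $\langle\cdot,\cdot\rangle$, and let $\mathbf I=\mathbb I+D\,\mathrm{Id}$. Realize the cotangent bundle of the unit sphere as $T^*S^{n-1}=\{(\gamma,p)\in\mathbb R^n\times\mathbb R^n:(\gamma,\gamma)=1,\ (\gamma,p)=0\}$, with the canonical symplectic form $\mathbf w=\sum_i dp_i\wedge d\gamma_i|_{T^*S^{n-1}}$. The reduced rubber-rolling equations on $T^*S^{n-1}$ are $$\dot\gamma=X_\gamma(p,\gamma),\qquad \dot p=X_p(p,\gamma),$$ where $X_\gamma$ is the inverse of the Legendre transformation,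 i.e. the unique vector with $(\gamma,X_\gamma)=0$ and $-\frac1{\epsilon^2}\mathbf I(\gamma\wedge X_\gamma)\gamma=p$, and $$X_p=\frac{1-\epsilon}{\epsilon^3}\,\mathbf I(\gamma\wedge X_\gamma)X_\gamma+\Big(\frac{\epsilon-1}{\epsilon^3}\big(\mathbf I(\gamma\wedge X_\gamma)X_\gamma,\gamma\big)-(X_\gamma,p)\Big)\gamma .$$ For a unit vector $\gamma$ let $\mathfrak v_\gamma=\mathbb R^n\wedge\gamma\subset so(n)$, let $\operatorname{pr}_{\mathfrak v_\gamma}$ be the orthogonal projection onto $\mathfrak v_\gamma$, and let $\det\mathbf I|_{\mathfrak v_\gamma}$ be the determinant of the operator $\operatorname{pr}_{\mathfrak v_\gamma}\circ\mathbf I$ on $\mathfrak v_\gamma$. Then the reduced equations preserve the measure $$\big(\det\mathbf I|_{\mathfrak v_\gamma}\big)^{\frac1{2\epsilon}-1}\,\mathbf w^{\,n-1}$$ on $T^*S^{n-1}$: if $T\in\mathbb R$ and $B\subseteq T^*S^{n-1}$ is a Borel set such that the solution with initial value $x$ exists in $T^*S^{n-1}$ between the times $0$ and $T$ for every $x\in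 B$, then the image of $B$ under the time-$T$ map has the same measure as $B$. -/

import Mathlib

open MeasureTheory Matrix Set
open scoped ENNReal

namespace RubberRolling

noncomputable section

/-! ### Bivectors in `so(n)` -/

/-- The Lie algebra `so(n)` of skew-symmetric real matrices. -/
abbrev So (n : ℕ) : Type := LieAlgebra.Orthogonal.so (Fin n) ℝ

theorem mem_so_iff {n : ℕ} (X : Matrix (Fin n) (Fin n) ℝ) :
    X ∈ LieAlgebra.Orthogonal.so (Fin n) ℝ ↔ Xᵀ = -X :=
  LieAlgebra.Orthogonal.mem_so _ _ X

/-- The linear map `x ↦ x ∧ y = x yᵀ - y xᵀ` from `ℝⁿ` to `so(n)`. -/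
def wedgeRight {n : ℕ} (y : Fin n → ℝ) : (Fin n → ℝ) →ₗ[ℝ] So n where
  toFun x := ⟨vecMulVec x y - vecMulVec y x, by
    rw [mem_so_iff]; ext i j; simp [vecMulVec_apply]; ring⟩
  map_add' x x' := by
    ext i j; simp [vecMulVec_apply]; ring
  map_smul' c x := by
    ext i j; simp [vecMulVec_apply]; ring

/-- The wedge product `x ∧ y = x yᵀ - y xᵀ`. -/
def wedge {n : ℕ} (x y : Fin n → ℝ) : So n := wedgeRight y x

/-- The invariant scalar product `⟨X, Y⟩ = -½ tr (X Y)` on `so(n)`. -/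
def soInner {n : ℕ} (X Y : So n) : ℝ := -(1 / 2) * (X.1 * Y.1).trace

/-- The linear map `X ↦ X x` from `so(n)` to `ℝⁿ`. -/
def evalAt {n : ℕ} (x : Fin n → ℝ) : So n →ₗ[ℝ] (Fin n → ℝ) where
  toFun X := X.1 *ᵥ x
  map_add' X Y := by simp [add_mulVec]
  map_smul' c X := by simp [smul_mulVec]

/-- The subspace `𝔳_γ = ℝⁿ ∧ γ` of `so(n)`. -/
def vSpace {n : ℕ} (γ : Fin n → ℝ) : Submodule ℝ (So n) := LinearMap.range (wedgeRight γ)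

/-- The map `X ↦ (X γ) ∧ γ`; for a unit vector `γ` it is the orthogonal projection of `so(n)` onto
`𝔳_γ`. -/
def prV {n : ℕ} (γ : Fin n → ℝ) : So n →ₗ[ℝ] vSpace γ :=
  (wedgeRight γ).rangeRestrict ∘ₗ evalAt γ

/-! ### The rolling ball and its reduced equations -/

/-- The data of a balanced `n`-dimensional ball of radius `ρ` and mass `m` which rolls over a fixed
sphere of radius `σ`. The number `sgn` is `1` if the ball rolls over the outer surface of the fixed
sphere, and `-1` if it rolls over the inner surface (`σ > ρ`) or is a shell around the fixed sphere
(`σ < ρ`). The inertia operator is an arbitrary symmetric positive definite operator on `so(n)`. -/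
structure Ball (n : ℕ) where
  σ : ℝ
  ρ : ℝ
  m : ℝ
  sgn : ℝ
  σ_pos : 0 < σ
  ρ_pos : 0 < ρ
  m_pos : 0 < m
  sgn_eq : sgn = 1 ∨ sgn = -1
  ne : σ + sgn * ρ ≠ 0
  inertia : So n →ₗ[ℝ] So n
  inertia_symm : ∀ X Y, soInner (inertia X) Y = soInner X (inertia Y)
  inertia_pos : ∀ X, X ≠ 0 → 0 < soInner (inertia X) X

namespace Ball

variable {n : ℕ} (b : Ball n)

/-- The parameter `ε = σ / (σ ± ρ)`. -/
def ε : ℝ := b.σ / (b.σ + b.sgn * b.ρ)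

/-- The modified inertia operator `𝐈 = 𝕀 + D`, where `D = m ρ²`. -/
def modInertia : So n →ₗ[ℝ] So n := b.inertia + (b.m * b.ρ ^ 2) • LinearMap.id

/-- The Legendre transformation `γ' ↦ p = -ε⁻² 𝐈(γ ∧ γ') γ`. -/
def legendre (γ v : Fin n → ℝ) : Fin n → ℝ :=
  -(1 / b.ε ^ 2) • ((b.modInertia (wedge γ v)).1 *ᵥ γ)

/-- The component `X_γ(p, γ)`: the vector `γ'` tangent to the sphere at `γ` whose Legendre
transform is `p`. -/
def velocity (γ p : Fin n → ℝ) : Fin n → ℝ :=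
  Function.invFunOn (b.legendre γ) {v | γ ⬝ᵥ v = 0} p

/-- The component `X_p(p, γ)`. -/
def force (γ p : Fin n → ℝ) : Fin n → ℝ :=
  let v := b.velocity γ p
  let F := (b.modInertia (wedge γ v)).1 *ᵥ v
  ((1 - b.ε) / b.ε ^ 3) • F + ((b.ε - 1) / b.ε ^ 3 * (F ⬝ᵥ γ) - v ⬝ᵥ p) • γ

/-- The vector field `(X_γ, X_p)` of the reduced equations, in the coordinates `(γ, p)`. -/
def field (x : (Fin n → ℝ) × (Fin n → ℝ)) : (Fin n → ℝ) × (Fin n → ℝ) :=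
  (b.velocity x.1 x.2, b.force x.1 x.2)

/-- The density `(det 𝐈|_{𝔳_γ}) ^ (1/(2ε) - 1)`, where `𝐈|_{𝔳_γ}` is the operator on `𝔳_γ` given by
the restriction of the quadratic form `⟨𝐈X, X⟩`, that is, `𝐈` followed by the orthogonal projection
onto `𝔳_γ`. -/
def density (γ : Fin n → ℝ) : ℝ :=
  (LinearMap.det (prV γ ∘ₗ b.modInertia ∘ₗ (vSpace γ).subtype)) ^ (1 / (2 * b.ε) - 1)

end Ball

/-! ### The cotangent bundle of the sphere and measures given by volume forms -/

/-- The cotangent bundle of the unit sphere in `ℝⁿ`, as the set of all `(γ, p)` with `(γ, γ) = 1`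
and `(γ, p) = 0`. -/
def cotangentSphere (n : ℕ) : Set ((Fin n → ℝ) × (Fin n → ℝ)) :=
  {x | x.1 ⬝ᵥ x.1 = 1 ∧ x.1 ⬝ᵥ x.2 = 0}

/-- The symplectic form `w = dp₁ ∧ dγ₁ + ⋯ + dpₙ ∧ dγₙ` in the coordinates `(γ, p)`. -/
def sympl {n : ℕ} (u v : (Fin n → ℝ) × (Fin n → ℝ)) : ℝ := u.2 ⬝ᵥ v.1 - v.2 ⬝ᵥ u.1

/-- The exterior power `w ^ k = w ∧ ⋯ ∧ w`, evaluated at `2k` vectors indexed by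
`(0,0), (0,1), (1,0), (1,1), …`. -/
def symplPow {n : ℕ} (k : ℕ) (v : Fin k × Fin 2 → (Fin n → ℝ) × (Fin n → ℝ)) : ℝ :=
  (1 / 2 ^ k) * ∑ s : Equiv.Perm (Fin k × Fin 2),
    (Equiv.Perm.sign s : ℝ) * ∏ i, sympl (v (s (i, 0))) (v (s (i, 1)))

/-- A patch: a `C¹` map from an open subset of `ℝ^{2(n-1)}` to `T*S^{n-1}`. -/
structure Patch (n : ℕ) where
  toFun : (Fin (n - 1) × Fin 2 → ℝ) → (Fin n → ℝ) × (Fin n → ℝ)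
  dom : Set (Fin (n - 1) × Fin 2 → ℝ)
  isOpen_dom : IsOpen dom
  contDiffOn : ContDiffOn ℝ 1 toFun dom
  mapsTo : MapsTo toFun dom (cotangentSphere n)

/-- The integral over `A` of the absolute value of the pull-back of the form `f w^{n-1}` under a
patch. -/
def Patch.mass {n : ℕ} (f : (Fin n → ℝ) → ℝ) (P : Patch n)
    (A : Set (Fin (n - 1) × Fin 2 → ℝ)) : ℝ≥0∞ :=
  ∫⁻ u in A, ENNReal.ofReal |f (P.toFun u).1 *
    symplPow (n - 1) (fun a => fderiv ℝ P.toFun u (Pi.single a 1))|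

/-- The infimum of the masses of all pieces of patches that cover `S`. -/
def patchMass {n : ℕ} (f : (Fin n → ℝ) → ℝ) (S : Set (cotangentSphere n)) : ℝ≥0∞ :=
  ⨅ (P : Patch n) (A : Set (Fin (n - 1) × Fin 2 → ℝ)) (_ : MeasurableSet A) (_ : A ⊆ P.dom)
    (_ : Subtype.val '' S ⊆ P.toFun '' A), P.mass f A

/-- The patch with empty domain. -/
def emptyPatch (n : ℕ) : Patch n where
  toFun := 0
  dom := ∅
  isOpen_dom := isOpen_empty
  contDiffOn := contDiffOn_empty
  mapsTo := mapsTo_empty _ _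

theorem patchMass_empty {n : ℕ} (f : (Fin n → ℝ) → ℝ) : patchMass f ∅ = 0 := by
  refine le_antisymm ?_ bot_le
  refine (iInf_le_of_le (emptyPatch n) (iInf_le_of_le ∅ (iInf_le_of_le MeasurableSet.empty
    (iInf_le_of_le (empty_subset _) (iInf_le_of_le (by simp) ?_)))))
  simp [Patch.mass]

theorem patchMass_split {n : ℕ} (f : (Fin n → ℝ) → ℝ) (S B : Set (cotangentSphere n))
    (hB : MeasurableSet B) : patchMass f (S ∩ B) + patchMass f (S \ B) ≤ patchMass f S := by
  obtain ⟨C, hC, rfl⟩ := hB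
  conv_rhs => unfold patchMass
  refine le_iInf fun P => le_iInf fun A => le_iInf fun hA => le_iInf fun hAP => le_iInf fun hS => ?_
  have hpre : MeasurableSet (A ∩ P.toFun ⁻¹' C) := by
    have h := P.contDiffOn.continuousOn.mono hAP
    have h2 := h.domRestrict.measurable hC
    have h3 := (MeasurableEmbedding.subtype_coe hA).measurableSet_image.2 h2
    convert h3 using 1
    ext u
    simp [and_comm]
  have h1 : patchMass f (S ∩ Subtype.val ⁻¹' C) ≤ P.mass f (A ∩ P.toFun ⁻¹' C) := by
    refine iInf_le_of_le P (iInf_le_of_le _ (iInf_le_of_le hpre (iInf_le_of_le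
      (inter_subset_left.trans hAP) (iInf_le_of_le ?_ le_rfl))))
    rintro _ ⟨x, ⟨hx, hxC⟩, rfl⟩
    obtain ⟨u, hu, hux⟩ := hS ⟨x, hx, rfl⟩
    exact ⟨u, ⟨hu, by simpa [hux] using hxC⟩, hux⟩
  have h2 : patchMass f (S \ Subtype.val ⁻¹' C) ≤ P.mass f (A \ (A ∩ P.toFun ⁻¹' C)) := by
    refine iInf_le_of_le P (iInf_le_of_le _ (iInf_le_of_le (hA.diff hpre) (iInf_le_of_le
      (sdiff_subset.trans hAP) (iInf_le_of_le ?_ le_rfl))))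
    rintro _ ⟨x, ⟨hx, hxC⟩, rfl⟩
    obtain ⟨u, hu, hux⟩ := hS ⟨x, hx, rfl⟩
    exact ⟨u, ⟨hu, fun h => hxC (by simpa [hux] using h.2)⟩, hux⟩
  refine (add_le_add h1 h2).trans (le_of_eq ?_)
  have h3 := lintegral_inter_add_sdiff (μ := volume) (fun u => ENNReal.ofReal |f (P.toFun u).1 *
    symplPow (n - 1) (fun a => fderiv ℝ P.toFun u (Pi.single a 1))|) A hpre
  have e : A ∩ (A ∩ P.toFun ⁻¹' C) = A ∩ P.toFun ⁻¹' C := by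
    rw [← inter_assoc, inter_self]
  rw [e] at h3
  exact h3

/-- The measure on `T*S^{n-1}` given by the volume form `f w^{n-1}`, where `f` depends on `γ`: the
measure of a Borel set is the infimum of the total masses of its countable covers by pieces of
patches. It takes the value `∫_A |ψ^*(f w^{n-1})|` at `ψ(A)` for an injective patch `ψ`. -/
def formMeasure {n : ℕ} (f : (Fin n → ℝ) → ℝ) : Measure (cotangentSphere n) :=
  (OuterMeasure.ofFunction (patchMass f) (patchMass_empty f)).toMeasure fun B hB =>
    OuterMeasure.ofFunction_caratheodory fun S => patchMass_split f S B hB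

/-! ### The vector field is well defined and tangent to the cotangent bundle -/

namespace Ball

variable {n : ℕ} (b : Ball n)

theorem skew_dot (X : So n) (x y : Fin n → ℝ) : x ⬝ᵥ (X.1 *ᵥ y) = -((X.1 *ᵥ x) ⬝ᵥ y) := by
  have h := (mem_so_iff X.1).1 X.2
  rw [dotProduct_mulVec, ← mulVec_transpose, h, neg_mulVec, neg_dotProduct]

theorem skew_dot_self (X : So n) (x : Fin n → ℝ) : x ⬝ᵥ (X.1 *ᵥ x) = 0 := by
  have h := skew_dot X x x
  rw [dotProduct_comm (X.1 *ᵥ x)] at h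
  linarith

theorem soInner_wedge (X : So n) (x y : Fin n → ℝ) : soInner X (wedge x y) = x ⬝ᵥ (X.1 *ᵥ y) := by
  have h : (X.1 * (wedge x y).1).trace = y ⬝ᵥ (X.1 *ᵥ x) - x ⬝ᵥ (X.1 *ᵥ y) := by
    simp [wedge, wedgeRight, mul_sub, mul_vecMulVec, trace_vecMulVec, dotProduct_comm]
  rw [soInner, h, skew_dot X y x, dotProduct_comm (X.1 *ᵥ y)]
  ring

theorem ε_ne : b.ε ≠ 0 := div_ne_zero b.σ_pos.ne' b.ne

theorem soInner_self_nonneg (X : So n) : 0 ≤ soInner X X := by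
  have h := (mem_so_iff X.1).1 X.2
  have h2 : X.1 * X.1 = -(X.1ᵀ * X.1) := by rw [h]; simp
  rw [soInner, h2, trace_neg]
  have : 0 ≤ (X.1ᵀ * X.1).trace := by
    simp only [trace, diag, mul_apply, transpose_apply]
    exact Finset.sum_nonneg fun i _ => Finset.sum_nonneg fun j _ => mul_self_nonneg _
  linarith

theorem modInertia_pos (X : So n) (hX : X ≠ 0) : 0 < soInner (b.modInertia X) X := by
  have h1 := b.inertia_pos X hX
  have h2 := soInner_self_nonneg X
  have h3 : soInner (b.modInertia X) X
      = soInner (b.inertia X) X + b.m * b.ρ ^ 2 * soInner X X := by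
    simp [soInner, modInertia, add_mul]; ring
  have h4 := b.m_pos
  rw [h3]
  positivity

theorem wedge_ne_zero {γ v : Fin n → ℝ} (hγ : γ ⬝ᵥ γ = 1) (hv : γ ⬝ᵥ v = 0) (h : v ≠ 0) :
    wedge γ v ≠ 0 := by
  intro h0
  apply h
  have h1 : (wedge γ v).1 *ᵥ γ = -v := by
    ext i
    simp [wedge, wedgeRight, sub_mulVec, vecMulVec_mulVec, dotProduct_comm v γ, hγ, hv]
  rw [h0] at h1
  simpa using h1.symm

/-- For a unit vector `γ` the Legendre transformation is a bijection of `T_γ S^{n-1}`, identified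
with its dual by the Euclidean scalar product. -/
theorem legendre_bijOn {γ : Fin n → ℝ} (hγ : γ ⬝ᵥ γ = 1) :
    BijOn (b.legendre γ) {v | γ ⬝ᵥ v = 0} {p | γ ⬝ᵥ p = 0} := by
  let T : Submodule ℝ (Fin n → ℝ) :=
    { carrier := {v | γ ⬝ᵥ v = 0}
      add_mem' := fun {x y} hx hy => by
        simp only [mem_ofPred_eq] at *
        rw [dotProduct_add, hx, hy, add_zero]
      zero_mem' := by simp
      smul_mem' := fun c x hx => by
        simp only [mem_ofPred_eq] at *
        rw [dotProduct_smul, hx, smul_zero] }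
  have hm : ∀ v, γ ⬝ᵥ b.legendre γ v = 0 := fun v => by
    simp [legendre, skew_dot_self]
  have hw : ∀ v, wedge γ v = -wedgeRight γ v := fun v => by
    ext i j; simp [wedge, wedgeRight]
  let L : T →ₗ[ℝ] T :=
    { toFun := fun v => ⟨b.legendre γ v.1, hm v.1⟩
      map_add' := fun x y => by
        ext i; simp [legendre, hw, add_mulVec]; ring
      map_smul' := fun c x => by
        apply Subtype.ext
        change b.legendre γ (c • x.1) = c • b.legendre γ x.1
        have h : (b.modInertia (wedge γ (c • x.1))).1 = c • (b.modInertia (wedge γ x.1)).1 := by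
          rw [hw, hw, map_smul, ← smul_neg, map_smul]; rfl
        rw [legendre, legendre, h, smul_mulVec, smul_comm] }
  have hinj : Function.Injective L := by
    rw [← LinearMap.ker_eq_bot, LinearMap.ker_eq_bot']
    intro v hv
    by_contra hne
    have hv' : (v : Fin n → ℝ) ≠ 0 := fun h => hne (Subtype.ext h)
    have hp := b.modInertia_pos _ (wedge_ne_zero hγ v.2 hv')
    have h0 : b.legendre γ v.1 = 0 := congrArg Subtype.val hv
    have h1 : (b.modInertia (wedge γ v.1)).1 *ᵥ γ = 0 := by
      have hε := b.ε_ne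
      simpa [legendre, hε] using h0
    rw [soInner_wedge, skew_dot, h1] at hp
    simp at hp
  have hsurj := LinearMap.surjective_of_injective hinj
  refine ⟨fun v _ => hm v, fun x hx y hy hxy => ?_, fun p hp => ?_⟩
  · exact congrArg Subtype.val (@hinj ⟨x, hx⟩ ⟨y, hy⟩ (Subtype.ext hxy))
  · obtain ⟨v, hv⟩ := hsurj ⟨p, hp⟩
    exact ⟨v.1, v.2, congrArg Subtype.val hv⟩

/-- The component `X_γ` is tangent to the sphere and is mapped to `p` by the Legendre
transformation. -/
theorem velocity_spec {γ p : Fin n → ℝ} (hγ : γ ⬝ᵥ γ = 1) (hp : γ ⬝ᵥ p = 0) :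
    γ ⬝ᵥ b.velocity γ p = 0 ∧ b.legendre γ (b.velocity γ p) = p := by
  have h := (b.legendre_bijOn hγ).surjOn hp
  exact ⟨Function.invFunOn_mem h, Function.invFunOn_eq h⟩

/-- The vector field is tangent to `T*S^{n-1}`: it annihilates `(γ, γ)` and `(γ, p)`. -/
theorem field_tangent {x : (Fin n → ℝ) × (Fin n → ℝ)} (hx : x ∈ cotangentSphere n) :
    x.1 ⬝ᵥ (b.field x).1 = 0 ∧ (b.field x).1 ⬝ᵥ x.2 + x.1 ⬝ᵥ (b.field x).2 = 0 := by
  refine ⟨(b.velocity_spec hx.1 hx.2).1, ?_⟩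
  simp only [field, force, dotProduct_add, dotProduct_smul, hx.1, smul_eq_mul]
  rw [dotProduct_comm x.1 (_ *ᵥ _)]
  ring

end Ball

end

end RubberRolling

/-! The equations extend to a field `extField`, smooth wherever `γ ≠ 0`, for which `(γ, γ)` and `(γ,
p)` are first integrals off the cotangent bundle as well. The derivative of its flow therefore
intertwines the differentials of the two constraints. Such an operator multiplies `w^{n-1}` on
tangent spaces by its full determinant on `ℝⁿ × ℝⁿ` (`symplPow_comp`), because tangent spaces at
different points are carried to each other by linear symplectic maps of determinant one. The
intrinsic divergence is thus the ordinary trace of the derivative of `extField`.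

This trace is computed with the symmetric operator `legendreOp γ`, which is the Legendre
transformation up to `ε²` on the tangent space and the identity on `γ`. Let `τ` be the trace of `δ ↦
(legendreOp γ)⁻¹ 𝐈(v ∧ δ) γ`, with `v` the velocity. The velocity contributes `-τ` and the force `(1
- ε)/ε · τ`, in total `(1/ε - 2) τ` (`tr_fderiv_extField`). The logarithmic derivative of `det
(legendreOp γ)` along the motion is `-2τ` (`tr_legendreOpDeriv_inv`). All other terms vanish, being
traces of a symmetric times a skew operator or of rank-one operators that die by orthogonality. By
Liouville's formula, `det (legendreOp γ)` to the power `1/(2ε) - 1` times the Jacobian is constant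
(`density_mul_det`), and this determinant is the one in the density (`det_compression`).

To pass to measures, solutions bounded by `R` are followed by the complete `C¹` flow of a truncated
field (`exists_localFlow`). Its time-one map transports patches without changing their mass where
the truncation is not felt. Letting `R` grow gives one inequality between the measures
(`formMeasure_le`), and reversing time gives the other. -/

namespace RubberRolling

/-! ### Differentiable dependence of flows on the initial condition -/

section Flow

open Metric
open scoped NNReal

variable {F : Type*} [NormedAddCommGroup F] [NormedSpace ℝ F]

/-- A crude form of Grönwall's inequality on the unit interval. -/
theorem norm_le_of_deriv_le {f f' : ℝ → F} {δ K ε : ℝ} (hδ : 0 ≤ δ) (hK : 0 ≤ K) (hε : 0 ≤ ε)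
    (hf : ∀ t ∈ Icc (0 : ℝ) 1, HasDerivWithinAt f (f' t) (Icc 0 1) t)
    (h0 : ‖f 0‖ ≤ δ) (hb : ∀ t ∈ Icc (0 : ℝ) 1, ‖f' t‖ ≤ K * ‖f t‖ + ε) :
    ∀ t ∈ Icc (0 : ℝ) 1, ‖f t‖ ≤ (δ + ε) * Real.exp (K + 1) := by
  intro t ht
  -- The constant `K + 1` replaces `K` so that the Grönwall bound never takes its degenerate form at
  -- zero, and so that `ε / (K + 1) ≤ ε`.
  have h := norm_le_gronwallBound_of_norm_deriv_right_le (f := f) (f' := f') (δ := δ) (K := K + 1)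
    (ε := ε) (a := 0) (b := 1) (fun t ht => (hf t ht).continuousWithinAt)
    (fun t ht => (hf t (Ico_subset_Icc_self ht)).mono_of_mem_nhdsWithin
      (Icc_mem_nhdsGE_of_mem ht)) h0
    (fun t ht => (hb t (Ico_subset_Icc_self ht)).trans (by nlinarith [norm_nonneg (f t)])) t ht
  refine h.trans ?_
  rw [gronwallBound_of_K_ne_0 (by positivity), sub_zero]
  have h1 : Real.exp ((K + 1) * t) ≤ Real.exp (K + 1) :=
    Real.exp_le_exp.2 (by nlinarith [ht.2])
  have h2 : ε / (K + 1) ≤ ε := div_le_self hε (by linarith)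
  have h3 : 0 ≤ Real.exp ((K + 1) * t) - 1 := by
    have := Real.one_le_exp (x := (K + 1) * t) (by nlinarith [ht.1])
    linarith
  nlinarith [mul_le_mul h2 (show Real.exp ((K + 1) * t) - 1 ≤ Real.exp (K + 1) by linarith) h3 hε,
    mul_le_mul_of_nonneg_left h1 hδ]

/-- A bounded Lipschitz field has solutions on the whole unit interval. -/
theorem exists_solution [CompleteSpace F] {f : ℝ → F → F} {K L : ℝ≥0}
    (hK : ∀ t ∈ Icc (0 : ℝ) 1, LipschitzWith K (f t))
    (hc : ∀ x, ContinuousOn (f · x) (Icc 0 1))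
    (hL : ∀ t ∈ Icc (0 : ℝ) 1, ∀ x, ‖f t x‖ ≤ L) (x₀ : F) :
    ∃ α : ℝ → F, α 0 = x₀ ∧ ∀ t ∈ Icc (0 : ℝ) 1, HasDerivWithinAt α (f t (α t)) (Icc 0 1) t := by
  -- At speed at most `L`, a solution cannot leave the ball of radius `L` in unit time.
  have h : IsPicardLindelof f (tmin := 0) (tmax := 1) ⟨0, by simp⟩ x₀ L 0 L K :=
    { lipschitzOnWith := fun t ht => (hK t ht).lipschitzOnWith
      continuousOn := fun x _ => hc x
      norm_le := fun t ht x _ => hL t ht x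
      mul_max_le := by simp }
  exact h.exists_eq_forall_mem_Icc_hasDerivWithinAt₀

/-- A linear equation with continuous coefficients has solutions on the whole unit interval. -/
theorem exists_linear_solution [FiniteDimensional ℝ F] {B : ℝ → F →L[ℝ] F}
    (hB : ContinuousOn B (Icc 0 1)) (x₀ : F) :
    ∃ α : ℝ → F, α 0 = x₀ ∧ ∀ t ∈ Icc (0 : ℝ) 1, HasDerivWithinAt α (B t (α t)) (Icc 0 1) t := by
  have := FiniteDimensional.complete ℝ F
  have := FiniteDimensional.proper ℝ F
  obtain ⟨K, hK⟩ := isCompact_Icc.exists_bound_of_continuousOn hB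
  have hK0 : 0 ≤ K := (norm_nonneg _).trans (hK 0 (by simp))
  -- Truncation makes the linear field bounded and Lipschitz. Grönwall's bound holds for the
  -- truncated equation too, so with this radius the solution stays where the bump function equals
  -- one.
  set ρ : ℝ := ‖x₀‖ * Real.exp (K + 1) + 1 with hρ
  have hρ0 : 0 < ρ := by positivity
  let η : ContDiffBump (0 : F) := ⟨ρ, ρ + 1, hρ0, by linarith⟩
  let g : F → F := fun x => η x • x
  have hg : ContDiff ℝ 1 g := η.contDiff.smul contDiff_id
  have hgc : HasCompactSupport g := η.hasCompactSupport.smul_right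
  obtain ⟨C, hC⟩ := ContDiff.lipschitzWith_of_hasCompactSupport hgc hg one_ne_zero
  obtain ⟨M, hM⟩ := hgc.exists_bound_of_continuous hg.continuous
  have hM0 : 0 ≤ M := (norm_nonneg _).trans (hM 0)
  obtain ⟨α, hα0, hα⟩ := exists_solution (f := fun t x => B t (g x)) (K := ⟨K, hK0⟩ * C)
    (L := ⟨K * M, by positivity⟩)
    (fun t ht => by
      refine LipschitzWith.comp (ContinuousLinearMap.lipschitzWith_of_opNorm_le ?_) hC
      exact hK t ht)
    (fun x => hB.clm_apply continuousOn_const)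
    (fun t ht x => ((B t).le_opNorm _).trans
      (mul_le_mul (hK t ht) (hM x) (norm_nonneg _) hK0)) x₀
  refine ⟨α, hα0, fun t ht => ?_⟩
  have hb := norm_le_of_deriv_le (f := α) (δ := ‖x₀‖) (K := K) (ε := 0) (norm_nonneg _) hK0 le_rfl
    hα (by rw [hα0]) (fun t ht => by
      rw [add_zero]
      refine ((B t).le_opNorm _).trans (mul_le_mul (hK t ht) ?_ (norm_nonneg _) hK0)
      simp only [g, norm_smul, Real.norm_eq_abs, abs_of_nonneg η.nonneg]
      exact mul_le_of_le_one_left (norm_nonneg _) η.le_one) t ht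
  have h1 : η (α t) = 1 := η.one_of_mem_closedBall (by
    rw [mem_closedBall, dist_zero_right]
    show _ ≤ ρ
    linarith)
  have := hα t ht
  simpa [g, h1] using this

/-- The flow of a compactly supported vector field of class `C²` is of class `C¹`, and its
derivative satisfies the variational equation. -/
theorem exists_flow [FiniteDimensional ℝ F] {Y : F → F} (hY : ContDiff ℝ 2 Y)
    (hYc : HasCompactSupport Y) :
    ∃ (Φ : ℝ → F → F) (A : ℝ → F → F →L[ℝ] F),
      (∀ x, Φ 0 x = x) ∧
      (∀ x, ∀ t ∈ Icc (0 : ℝ) 1, HasDerivWithinAt (Φ · x) (Y (Φ t x)) (Icc 0 1) t) ∧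
      (∀ x, A 0 x = ContinuousLinearMap.id ℝ F) ∧
      (∀ x, ∀ t ∈ Icc (0 : ℝ) 1,
        HasDerivWithinAt (A · x) ((fderiv ℝ Y (Φ t x)).comp (A t x)) (Icc 0 1) t) ∧
      (∀ x, ∀ t ∈ Icc (0 : ℝ) 1, HasFDerivAt (Φ t) (A t x) x) ∧
      (∀ t ∈ Icc (0 : ℝ) 1, Continuous (A t)) := by
  have := FiniteDimensional.complete ℝ F
  have hY1 : ContDiff ℝ 1 Y := hY.of_le one_le_two
  have hD1 : ContDiff ℝ 1 (fderiv ℝ Y) := hY.fderiv_right (by norm_num [one_add_one_eq_two])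
  obtain ⟨K, hK⟩ := ContDiff.lipschitzWith_of_hasCompactSupport hYc hY1 one_ne_zero
  obtain ⟨K₂, hK₂⟩ := ContDiff.lipschitzWith_of_hasCompactSupport (hYc.fderiv ℝ) hD1 one_ne_zero
  obtain ⟨L, hL⟩ := hYc.exists_bound_of_continuous hY1.continuous
  have hL0 : 0 ≤ L := (norm_nonneg _).trans (hL 0)
  have hDK : ∀ x, ‖fderiv ℝ Y x‖ ≤ K := fun x => norm_fderiv_le_of_lipschitz ℝ hK
  choose α hα0 hα using exists_solution (f := fun _ => Y) (K := K) (L := ⟨L, hL0⟩) (fun _ _ => hK)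
    (fun _ => continuousOn_const) (fun _ _ => hL)
  have hαc : ∀ x, ContinuousOn (α x) (Icc 0 1) := fun x t ht => (hα x t ht).continuousWithinAt
  -- The variational equation is a linear equation on the space of operators, with coefficient given
  -- by left composition with the derivative of `Y`.
  choose A hA0 hA using fun x => exists_linear_solution
    (B := fun t => ContinuousLinearMap.compL ℝ F F F (fderiv ℝ Y (α x t)))
    ((ContinuousLinearMap.compL ℝ F F F).continuous.comp_continuousOn
      (hD1.continuous.comp_continuousOn (hαc x))) (ContinuousLinearMap.id ℝ F)
  set c : ℝ := Real.exp (K + 1) with hc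
  have hc0 : 0 < c := Real.exp_pos _
  have hlip : ∀ x y, ∀ t ∈ Icc (0 : ℝ) 1, ‖α y t - α x t‖ ≤ ‖y - x‖ * c := fun x y t ht => by
    have := norm_le_of_deriv_le (f := fun t => α y t - α x t) (δ := ‖y - x‖) (K := K) (ε := 0)
      (norm_nonneg _) K.2 le_rfl (fun t ht => (hα y t ht).sub (hα x t ht)) (by simp [hα0])
      (fun t ht => by simpa using hK.norm_sub_le _ _) t ht
    simpa using this
  have hAb : ∀ x, ∀ t ∈ Icc (0 : ℝ) 1, ‖A x t‖ ≤ c := fun x t ht => by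
    have := norm_le_of_deriv_le (f := A x) (δ := 1) (K := K) (ε := 0) zero_le_one K.2 le_rfl
      (hA x) (by rw [hA0]; exact ContinuousLinearMap.norm_id_le) (fun t ht => by
        rw [add_zero, ContinuousLinearMap.compL_apply]
        exact (ContinuousLinearMap.opNorm_comp_le _ _).trans
          (mul_le_mul_of_nonneg_right (hDK _) (norm_nonneg _))) t ht
    simpa using this
  have htaylor : ∀ x y, ‖Y y - Y x - fderiv ℝ Y x (y - x)‖ ≤ K₂ * ‖y - x‖ ^ 2 := fun x y => by
    have h := (convex_segment x y).norm_image_sub_le_of_norm_hasFDerivWithin_le' (f := Y)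
      (f' := fderiv ℝ Y) (φ := fderiv ℝ Y x) (C := K₂ * ‖y - x‖) (x := x) (y := y)
      (fun z _ => (hY1.differentiable one_ne_zero z).hasFDerivAt.hasFDerivWithinAt)
      (fun z hz => (hK₂.norm_sub_le _ _).trans
        (mul_le_mul_of_nonneg_left (norm_sub_le_of_mem_segment hz) K₂.2))
      (left_mem_segment ℝ x y) (right_mem_segment ℝ x y)
    rwa [mul_assoc, ← sq] at h
  refine ⟨fun t x => α x t, fun t x => A x t, hα0, hα, hA0, hA, fun x t ht => ?_, fun t ht => ?_⟩
  -- The error of the linear approximation solves the variational equation up to a term quadratic in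
  -- the initial displacement, so Grönwall's inequality keeps it quadratic.
  · have hb : ∀ y, ‖α y t - α x t - A x t (y - x)‖ ≤ K₂ * c ^ 3 * ‖y - x‖ ^ 2 := fun y => by
      have := norm_le_of_deriv_le (f := fun t => α y t - α x t - A x t (y - x)) (δ := 0) (K := K)
        (ε := K₂ * (‖y - x‖ * c) ^ 2) le_rfl K.2 (by positivity)
        (fun t ht => ((hα y t ht).sub (hα x t ht)).sub
          ((hA x t ht).clm_apply (hasDerivWithinAt_const t _ (y - x))))
        (by simp [hα0, hA0]) (fun t ht => by
          have e : Y (α y t) - Y (α x t) - (((ContinuousLinearMap.compL ℝ F F F)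
              (fderiv ℝ Y (α x t)) (A x t)) (y - x) + A x t 0)
              = fderiv ℝ Y (α x t) (α y t - α x t - A x t (y - x))
                + (Y (α y t) - Y (α x t) - fderiv ℝ Y (α x t) (α y t - α x t)) := by
            simp [map_sub]
          rw [e]
          refine (norm_add_le _ _).trans (add_le_add ?_ ?_)
          · exact (ContinuousLinearMap.le_opNorm _ _).trans
              (mul_le_mul_of_nonneg_right (hDK _) (norm_nonneg _))
          · refine (htaylor _ _).trans (mul_le_mul_of_nonneg_left ?_ K₂.2)
            gcongr
            exact hlip x y t ht) t ht
      refine this.trans (le_of_eq ?_)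
      rw [← hc]; ring
    rw [hasFDerivAt_iff_isLittleO]
    refine Asymptotics.IsBigO.trans_isLittleO (g := fun y => ‖y - x‖ ^ 2)
      (Asymptotics.IsBigO.of_bound (K₂ * c ^ 3) (Filter.Eventually.of_forall fun y => ?_)) ?_
    · simpa using hb y
    · exact Asymptotics.isLittleO_pow_sub_sub x one_lt_two
  · have hb : ∀ x y, ‖A y t - A x t‖ ≤ K₂ * c ^ 3 * ‖y - x‖ := fun x y => by
      have := norm_le_of_deriv_le (f := fun t => A y t - A x t) (δ := 0) (K := K)
        (ε := K₂ * (‖y - x‖ * c) * c) le_rfl K.2 (by positivity)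
        (fun t ht => (hA y t ht).sub (hA x t ht))
        (by simp [hA0]) (fun t ht => by
          have e : (ContinuousLinearMap.compL ℝ F F F (fderiv ℝ Y (α y t))) (A y t)
              - (ContinuousLinearMap.compL ℝ F F F (fderiv ℝ Y (α x t))) (A x t)
              = (fderiv ℝ Y (α y t)).comp (A y t - A x t)
                + (fderiv ℝ Y (α y t) - fderiv ℝ Y (α x t)).comp (A x t) := by
            ext z; simp
          rw [e]
          refine (norm_add_le _ _).trans (add_le_add ?_ ?_)
          · exact (ContinuousLinearMap.opNorm_comp_le _ _).trans
              (mul_le_mul_of_nonneg_right (hDK _) (norm_nonneg _))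
          · refine (ContinuousLinearMap.opNorm_comp_le _ _).trans ?_
            refine mul_le_mul ?_ (hAb x t ht) (norm_nonneg _) (by positivity)
            refine (hK₂.norm_sub_le _ _).trans (mul_le_mul_of_nonneg_left ?_ K₂.2)
            exact hlip x y t ht) t ht
      refine this.trans (le_of_eq ?_)
      rw [← hc]; ring
    exact (LipschitzWith.of_dist_le_mul (K := ⟨K₂ * c ^ 3, by positivity⟩) fun x y => by
      rw [dist_eq_norm, dist_eq_norm]; exact hb y x).continuous

end Flow

/-! ### The derivative of a determinant -/

/-- Jacobi's formula. The product rule in the Leibniz expansion replaces one column at a time by its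
derivative, and Cramer's rule identifies each resulting determinant with a diagonal entry of the
adjugate times `A'`. -/
theorem hasDerivWithinAt_matrix_det {m : Type*} [Fintype m] [DecidableEq m]
    {A : ℝ → Matrix m m ℝ} {A' : Matrix m m ℝ} {s : Set ℝ} {t : ℝ}
    (h : ∀ i j, HasDerivWithinAt (fun u => A u i j) (A' i j) s t) :
    HasDerivWithinAt (fun u => (A u).det) ((A t).adjugate * A').trace s t := by
  have h1 : HasDerivWithinAt (fun u => (A u).det)
      (∑ σ : Equiv.Perm m, (Equiv.Perm.sign σ : ℝ) *
        ∑ i, (∏ j ∈ Finset.univ.erase i, A t (σ j) j) • A' (σ i) i) s t := by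
    simp only [Matrix.det_apply']
    exact HasDerivWithinAt.fun_sum fun σ _ =>
      (HasDerivWithinAt.fun_finsetProd fun i _ => h (σ i) i).const_mul _
  convert h1 using 1
  have h2 : ∀ i, ((A t).adjugate * A') i i = ((A t).updateCol i (fun k => A' k i)).det := by
    intro i
    rw [← Matrix.cramer_apply, Matrix.cramer_eq_adjugate_mulVec]
    rfl
  simp only [Matrix.trace, Matrix.diag, h2, Matrix.det_apply', Finset.mul_sum]
  rw [Finset.sum_comm]
  refine Finset.sum_congr rfl fun σ _ => Finset.sum_congr rfl fun i _ => ?_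
  rw [← Finset.mul_prod_erase _ _ (Finset.mem_univ i)]
  congr 1
  rw [mul_comm, smul_eq_mul]
  congr 1
  · exact Finset.prod_congr rfl fun j hj => by
      rw [Matrix.updateCol_ne (Finset.ne_of_mem_erase hj)]
  · simp

/-- **Liouville's formula**: if `L' = D L`, then `(det L)' = tr D · det L`. -/
theorem hasDerivWithinAt_det {F : Type*} [NormedAddCommGroup F] [NormedSpace ℝ F]
    [FiniteDimensional ℝ F] {L : ℝ → F →L[ℝ] F} {D : F →L[ℝ] F} {s : Set ℝ} {t : ℝ}
    (h : HasDerivWithinAt L (D.comp (L t)) s t) :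
    HasDerivWithinAt (fun u => LinearMap.det (L u : F →ₗ[ℝ] F))
      (LinearMap.trace ℝ F D * LinearMap.det (L t : F →ₗ[ℝ] F)) s t := by
  let e := Module.finBasis ℝ F
  have h1 := hasDerivWithinAt_matrix_det (A := fun u => LinearMap.toMatrix e e (L u))
    (A' := LinearMap.toMatrix e e (D.comp (L t))) (s := s) (t := t) (fun i j => by
      simp only [LinearMap.toMatrix_apply, ContinuousLinearMap.coe_coe]
      have h2 := (h.clm_apply (hasDerivWithinAt_const t s (e j)))
      have h3 := (LinearMap.toContinuousLinearMap (e.coord i)).hasFDerivAt.comp_hasDerivWithinAt t h2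
      rw [map_zero, add_zero] at h3
      exact h3)
  simp only [LinearMap.det_toMatrix] at h1
  convert h1 using 1
  rw [ContinuousLinearMap.toLinearMap_comp, LinearMap.toMatrix_comp e e e, Matrix.trace_mul_comm,
    Matrix.mul_assoc, Matrix.mul_adjugate, Matrix.mul_smul, mul_one, Matrix.trace_smul,
    LinearMap.det_toMatrix, LinearMap.trace_eq_matrix_trace ℝ e, smul_eq_mul, mul_comm]

/-! ### Traces of operators on `ℝⁿ` -/

section Trace

variable {n : ℕ}

/-- The scalar product of `ℝⁿ` as a continuous bilinear map. -/
noncomputable def dotL (n : ℕ) : (Fin n → ℝ) →L[ℝ] (Fin n → ℝ) →L[ℝ] ℝ :=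
  LinearMap.toContinuousLinearMap
    { toFun := fun x => LinearMap.toContinuousLinearMap
        { toFun := fun y => x ⬝ᵥ y
          map_add' := dotProduct_add x
          map_smul' := fun c y => dotProduct_smul c x y }
      map_add' := fun x x' => by ext y; simp
      map_smul' := fun c x => by ext y; simp }

@[simp] theorem dotL_apply (x y : Fin n → ℝ) : dotL n x y = x ⬝ᵥ y := rfl

/-- The trace of a continuous linear map. -/
noncomputable def tr {F : Type*} [NormedAddCommGroup F] [NormedSpace ℝ F] (L : F →L[ℝ] F) : ℝ :=
  LinearMap.trace ℝ F L

section

variable {F : Type*} [NormedAddCommGroup F] [NormedSpace ℝ F]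

theorem tr_add (X Y : F →L[ℝ] F) : tr (X + Y) = tr X + tr Y := by simp [tr]

theorem tr_sub (X Y : F →L[ℝ] F) : tr (X - Y) = tr X - tr Y := by simp [tr]

theorem tr_neg (X : F →L[ℝ] F) : tr (-X) = -tr X := by simp [tr]

theorem tr_smul (c : ℝ) (X : F →L[ℝ] F) : tr (c • X) = c * tr X := by simp [tr]

theorem tr_comp_comm {G : Type*} [NormedAddCommGroup G] [NormedSpace ℝ G]
    [FiniteDimensional ℝ F] [FiniteDimensional ℝ G] (X : F →L[ℝ] G) (Y : G →L[ℝ] F) :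
    tr (X.comp Y) = tr (Y.comp X) := by
  simp only [tr, ContinuousLinearMap.toLinearMap_comp]
  exact LinearMap.trace_comp_comm' _ _

theorem tr_smulRight [FiniteDimensional ℝ F] (l : F →L[ℝ] ℝ) (c : F) :
    tr (l.smulRight c) = l c :=
  LinearMap.trace_smulRight (l : F →ₗ[ℝ] ℝ) c

/-- The trace of an operator on a product is the sum of the traces of its diagonal blocks. -/
theorem tr_prod {G : Type*} [NormedAddCommGroup G] [NormedSpace ℝ G] [FiniteDimensional ℝ F]
    [FiniteDimensional ℝ G] (X : F × G →L[ℝ] F × G) :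
    tr X = tr ((ContinuousLinearMap.fst ℝ F G).comp (X.comp (ContinuousLinearMap.inl ℝ F G)))
      + tr ((ContinuousLinearMap.snd ℝ F G).comp (X.comp (ContinuousLinearMap.inr ℝ F G))) := by
  have h : X = (X.comp (ContinuousLinearMap.inl ℝ F G)).comp (ContinuousLinearMap.fst ℝ F G)
      + (X.comp (ContinuousLinearMap.inr ℝ F G)).comp (ContinuousLinearMap.snd ℝ F G) := by
    have h0 : X (0, 0) = 0 := map_zero X
    ext z <;> simp [h0]
  conv_lhs => rw [h, tr_add, tr_comp_comm, tr_comp_comm (X.comp (ContinuousLinearMap.inr ℝ F G))]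

end

theorem tr_eq_sum (L : (Fin n → ℝ) →L[ℝ] (Fin n → ℝ)) :
    tr L = ∑ i, L (Pi.single i 1) i := by
  rw [tr, LinearMap.trace_eq_matrix_trace ℝ (Pi.basisFun ℝ (Fin n))]
  simp [Matrix.trace]

/-- Adjoint operators have the same trace. -/
theorem tr_eq_of_adjoint {X Y : (Fin n → ℝ) →L[ℝ] (Fin n → ℝ)}
    (h : ∀ x y, x ⬝ᵥ X y = y ⬝ᵥ Y x) : tr X = tr Y := by
  rw [tr_eq_sum, tr_eq_sum]
  exact Finset.sum_congr rfl fun i _ => by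
    simpa using h (Pi.single i 1) (Pi.single i 1)

/-- The adjoint of `N X` is `-X N`, which by cyclicity has trace opposite to that of `N X`. -/
theorem tr_symm_comp_skew {N X : (Fin n → ℝ) →L[ℝ] (Fin n → ℝ)}
    (hN : ∀ x y, x ⬝ᵥ N y = y ⬝ᵥ N x) (hX : ∀ x y, x ⬝ᵥ X y = -(y ⬝ᵥ X x)) :
    tr (N.comp X) = 0 := by
  have h : tr (N.comp X) = tr (-(X.comp N)) := tr_eq_of_adjoint fun x y => by
    simp only [ContinuousLinearMap.comp_apply, _root_.neg_apply, dotProduct_neg]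
    rw [hN, dotProduct_comm, hX, dotProduct_comm]
  rw [tr_neg, tr_comp_comm X N] at h
  linarith

end Trace

/-! ### The tensor `𝐈(x ∧ y) z` -/

namespace Ball

variable {n : ℕ} (b : Ball n)

theorem wedge_add_left (x x' y : Fin n → ℝ) : wedge (x + x') y = wedge x y + wedge x' y :=
  map_add (wedgeRight y) x x'

theorem wedge_smul_left (c : ℝ) (x y : Fin n → ℝ) : wedge (c • x) y = c • wedge x y :=
  map_smul (wedgeRight y) c x

theorem wedge_swap (x y : Fin n → ℝ) : wedge x y = -wedge y x := by
  ext i j; simp [wedge, wedgeRight]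

theorem wedge_add_right (x y y' : Fin n → ℝ) : wedge x (y + y') = wedge x y + wedge x y' := by
  rw [wedge_swap, wedge_add_left, wedge_swap x y, wedge_swap x y', neg_add]

theorem wedge_smul_right (c : ℝ) (x y : Fin n → ℝ) : wedge x (c • y) = c • wedge x y := by
  rw [wedge_swap, wedge_smul_left, wedge_swap x y, smul_neg]

theorem wedge_mulVec (x y z : Fin n → ℝ) :
    (wedge x y).1 *ᵥ z = (y ⬝ᵥ z) • x - (x ⬝ᵥ z) • y := by
  ext i
  simp [wedge, wedgeRight, sub_mulVec, vecMulVec_mulVec]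

/-- The trilinear map `(x, y, z) ↦ 𝐈(x ∧ y) z`. -/
noncomputable def tensor :
    (Fin n → ℝ) →L[ℝ] (Fin n → ℝ) →L[ℝ] (Fin n → ℝ) →L[ℝ] (Fin n → ℝ) :=
  LinearMap.toContinuousLinearMap
    { toFun := fun x => LinearMap.toContinuousLinearMap
        { toFun := fun y => LinearMap.toContinuousLinearMap (b.modInertia (wedge x y)).1.mulVecLin
          map_add' := fun y y' => by
            ext z; simp [wedge_add_right]
          map_smul' := fun c y => by
            ext z; simp [wedge_smul_right] }
      map_add' := fun x x' => by
        ext y z; simp [wedge_add_left]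
      map_smul' := fun c x => by
        ext y z; simp [wedge_smul_left] }

theorem tensor_apply (x y z : Fin n → ℝ) :
    b.tensor x y z = (b.modInertia (wedge x y)).1 *ᵥ z := rfl

theorem tensor_swap (x y z : Fin n → ℝ) : b.tensor x y z = -b.tensor y x z := by
  rw [tensor_apply, tensor_apply, wedge_swap, map_neg]
  exact neg_mulVec _ _

@[simp] theorem tensor_self (x z : Fin n → ℝ) : b.tensor x x z = 0 := by
  have h := b.tensor_swap x x z
  exact self_eq_neg.1 h

theorem tensor_skew (x y z w : Fin n → ℝ) : w ⬝ᵥ b.tensor x y z = -(z ⬝ᵥ b.tensor x y w) := by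
  rw [tensor_apply, tensor_apply, skew_dot, dotProduct_comm]

@[simp] theorem dot_tensor_self (x y z : Fin n → ℝ) : z ⬝ᵥ b.tensor x y z = 0 :=
  skew_dot_self _ _

theorem soInner_comm (X Y : So n) : soInner X Y = soInner Y X := by
  rw [soInner, soInner, trace_mul_comm]

theorem modInertia_symm (X Y : So n) :
    soInner (b.modInertia X) Y = soInner X (b.modInertia Y) := by
  have h1 : soInner (b.modInertia X) Y = soInner (b.inertia X) Y + b.m * b.ρ ^ 2 * soInner X Y := by
    simp [soInner, modInertia, add_mul]; ring
  have h2 : soInner X (b.modInertia Y) = soInner X (b.inertia Y) + b.m * b.ρ ^ 2 * soInner X Y := by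
    simp [soInner, modInertia, mul_add]; ring
  rw [h1, h2, b.inertia_symm]

/-- The pair symmetry of a curvature-like tensor: both sides are values of the symmetric form `⟨𝐈 ·,
·⟩` on the bivectors `x ∧ y` and `w ∧ z`. -/
theorem tensor_pair (x y z w : Fin n → ℝ) : w ⬝ᵥ b.tensor x y z = x ⬝ᵥ b.tensor w z y := by
  rw [tensor_apply, tensor_apply, ← soInner_wedge, ← soInner_wedge, modInertia_symm, soInner_comm]

/-! ### The operator extending the Legendre transformation -/

/-- The bilinear map `(x, y) ↦ (v ↦ 𝐈(v ∧ x) y + (x, v) y)`. -/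
noncomputable def legendreForm :
    (Fin n → ℝ) →L[ℝ] (Fin n → ℝ) →L[ℝ] (Fin n → ℝ) →L[ℝ] (Fin n → ℝ) :=
  LinearMap.toContinuousLinearMap
    { toFun := fun x => LinearMap.toContinuousLinearMap
        { toFun := fun y => (b.tensor.flip x).flip y + (dotL n x).smulRight y
          map_add' := fun y y' => by
            ext v i; simp; ring
          map_smul' := fun c y => by
            ext v i; simp; ring }
      map_add' := fun x x' => by
        ext y v i; simp; ring
      map_smul' := fun c x => by
        ext y v i; simp; ring }

theorem legendreForm_apply (x y v : Fin n → ℝ) :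
    b.legendreForm x y v = b.tensor v x y + (x ⬝ᵥ v) • y := rfl

/-- The operator `v ↦ 𝐈(v ∧ γ) γ + (γ, v) γ`. For a unit vector `γ` it is `ε²` times the Legendre
transformation on the tangent space of the sphere, and the identity on `γ`. -/
noncomputable def legendreOp (γ : Fin n → ℝ) : (Fin n → ℝ) →L[ℝ] (Fin n → ℝ) :=
  b.legendreForm γ γ

theorem legendreOp_apply (γ v : Fin n → ℝ) :
    b.legendreOp γ v = b.tensor v γ γ + (γ ⬝ᵥ v) • γ := rfl

theorem legendreOp_symm (γ x y : Fin n → ℝ) :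
    x ⬝ᵥ b.legendreOp γ y = y ⬝ᵥ b.legendreOp γ x := by
  simp only [legendreOp_apply, dotProduct_add, dotProduct_smul, smul_eq_mul]
  rw [b.tensor_pair, dotProduct_comm x γ, dotProduct_comm y γ]
  ring

theorem dot_legendreOp (γ v : Fin n → ℝ) :
    γ ⬝ᵥ b.legendreOp γ v = (γ ⬝ᵥ v) * (γ ⬝ᵥ γ) := by
  simp [legendreOp_apply]

theorem legendreOp_self {γ : Fin n → ℝ} (hγ : γ ⬝ᵥ γ = 1) : b.legendreOp γ γ = γ := by
  simp [legendreOp_apply, hγ]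

/-- The quadratic form equals `⟨𝐈(v ∧ γ), v ∧ γ⟩ + (γ, v)²`. If the first term vanishes then `v` is
parallel to `γ`, and the second is positive. No normalization of `γ` is needed, so the operator is
invertible on a whole neighbourhood of the sphere. -/
theorem legendreOp_pos {γ v : Fin n → ℝ} (hγ : γ ≠ 0) (hv : v ≠ 0) :
    0 < v ⬝ᵥ b.legendreOp γ v := by
  have h1 : v ⬝ᵥ b.tensor v γ γ = soInner (b.modInertia (wedge v γ)) (wedge v γ) := by
    rw [soInner_wedge, tensor_apply]
  rw [legendreOp_apply, dotProduct_add, h1, dotProduct_smul, smul_eq_mul, dotProduct_comm v γ]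
  by_cases hw : wedge v γ = 0
  · have h2 := wedge_mulVec v γ γ
    rw [hw] at h2
    have h3 : γ ⬝ᵥ v ≠ 0 := by
      intro h3
      rw [dotProduct_comm v γ, h3, zero_smul, sub_zero] at h2
      have h4 : (γ ⬝ᵥ γ) • v = 0 := by rw [← h2]; simp
      rcases smul_eq_zero.1 h4 with h | h
      · exact hγ (dotProduct_self_eq_zero.1 h)
      · exact hv h
    have h5 : soInner (b.modInertia (wedge v γ)) (wedge v γ) = 0 := by
      rw [hw]; simp [soInner]
    rw [h5, zero_add]
    exact mul_self_pos.2 h3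
  · have := b.modInertia_pos _ hw
    nlinarith [mul_self_nonneg (γ ⬝ᵥ v)]

theorem det_legendreOp_pos {γ : Fin n → ℝ} (hγ : γ ≠ 0) :
    0 < LinearMap.det (b.legendreOp γ : (Fin n → ℝ) →ₗ[ℝ] (Fin n → ℝ)) := by
  rw [← LinearMap.det_toMatrix']
  have hm : ∀ v, LinearMap.toMatrix' (b.legendreOp γ : (Fin n → ℝ) →ₗ[ℝ] (Fin n → ℝ)) *ᵥ v
      = b.legendreOp γ v := fun v => LinearMap.toMatrix'_mulVec _ _
  refine Matrix.PosDef.det_pos (Matrix.PosDef.of_dotProduct_mulVec_pos ?_ fun v hv => ?_)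
  · ext i j
    have := b.legendreOp_symm γ (Pi.single j 1) (Pi.single i 1)
    simpa [LinearMap.toMatrix'_apply] using this
  · rw [hm]
    simpa using b.legendreOp_pos hγ hv

theorem isUnit_legendreOp {γ : Fin n → ℝ} (hγ : γ ≠ 0) : IsUnit (b.legendreOp γ) := by
  have h := (b.det_legendreOp_pos hγ).ne'
  let e := (LinearMap.equivOfDetNeZero _ h).toContinuousLinearEquiv
  exact ⟨(ContinuousLinearEquiv.unitsEquiv ℝ (Fin n → ℝ)).symm e, rfl⟩

/-- The inverse of `legendreOp`. -/
noncomputable def legendreInv (γ : Fin n → ℝ) : (Fin n → ℝ) →L[ℝ] (Fin n → ℝ) :=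
  Ring.inverse (b.legendreOp γ)

theorem legendreOp_inv {γ : Fin n → ℝ} (hγ : γ ≠ 0) (v : Fin n → ℝ) :
    b.legendreOp γ (b.legendreInv γ v) = v :=
  congrArg (fun L : (Fin n → ℝ) →L[ℝ] (Fin n → ℝ) => L v)
    (Ring.mul_inverse_cancel _ (b.isUnit_legendreOp hγ))

theorem legendreInv_op {γ : Fin n → ℝ} (hγ : γ ≠ 0) (v : Fin n → ℝ) :
    b.legendreInv γ (b.legendreOp γ v) = v :=
  congrArg (fun L : (Fin n → ℝ) →L[ℝ] (Fin n → ℝ) => L v)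
    (Ring.inverse_mul_cancel _ (b.isUnit_legendreOp hγ))

theorem legendreInv_symm {γ : Fin n → ℝ} (hγ : γ ≠ 0) (x y : Fin n → ℝ) :
    x ⬝ᵥ b.legendreInv γ y = y ⬝ᵥ b.legendreInv γ x := by
  conv_lhs => rw [← b.legendreOp_inv hγ x, dotProduct_comm, b.legendreOp_symm,
    b.legendreOp_inv hγ, dotProduct_comm]

theorem ne_zero_of_unit {γ : Fin n → ℝ} (hγ : γ ⬝ᵥ γ = 1) : γ ≠ 0 := by
  rintro rfl
  simp at hγ

theorem legendreInv_self {γ : Fin n → ℝ} (hγ : γ ⬝ᵥ γ = 1) : b.legendreInv γ γ = γ := by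
  have h := b.legendreInv_op (ne_zero_of_unit hγ) γ
  rwa [b.legendreOp_self hγ] at h

theorem contDiff_legendreOp {k : WithTop ℕ∞} : ContDiff ℝ k b.legendreOp := by
  unfold legendreOp
  fun_prop

theorem contDiffAt_legendreInv {k : WithTop ℕ∞} {γ : Fin n → ℝ} (hγ : γ ≠ 0) :
    ContDiffAt ℝ k b.legendreInv γ := by
  obtain ⟨u, hu⟩ := b.isUnit_legendreOp hγ
  exact ContDiffAt.comp γ (hu ▸ contDiffAt_ringInverse ℝ u) b.contDiff_legendreOp.contDiffAt

end Ball

namespace Ball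

variable {n : ℕ} (b : Ball n)

/-! ### Extension of the reduced equations to a neighbourhood of the cotangent bundle -/

/-- The component of `p` orthogonal to `γ`. -/
noncomputable def tangentPart (γ p : Fin n → ℝ) : Fin n → ℝ :=
  p - (dotL n γ p / dotL n γ γ) • γ

/-- The velocity component of the extended field. -/
noncomputable def extVelocity (γ p : Fin n → ℝ) : Fin n → ℝ :=
  b.ε ^ 2 • b.legendreInv γ (tangentPart γ p)

/-- The momentum component of the extended field, where `v` stands for the velocity. -/
noncomputable def extForceOf (γ p v : Fin n → ℝ) : Fin n → ℝ :=
  ((1 - b.ε) / b.ε ^ 3) • b.tensor γ v v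
    - ((dotL n v p + (1 - b.ε) / b.ε ^ 3 * dotL n γ (b.tensor γ v v)) / dotL n γ γ) • γ

/-- A vector field, smooth for `γ ≠ 0`, which coincides with the reduced equations on the cotangent
bundle of the sphere and has the first integrals `(γ, γ)` and `(γ, p)`. -/
noncomputable def extField (x : (Fin n → ℝ) × (Fin n → ℝ)) : (Fin n → ℝ) × (Fin n → ℝ) :=
  (b.extVelocity x.1 x.2, b.extForceOf x.1 x.2 (b.extVelocity x.1 x.2))

theorem dotL_self_ne {γ : Fin n → ℝ} (hγ : γ ≠ 0) : dotL n γ γ ≠ 0 := fun h =>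
  hγ (dotProduct_self_eq_zero.1 h)

theorem contDiffAt_extVelocity {k : WithTop ℕ∞} {x : (Fin n → ℝ) × (Fin n → ℝ)} (hx : x.1 ≠ 0) :
    ContDiffAt ℝ k (fun x : (Fin n → ℝ) × (Fin n → ℝ) => b.extVelocity x.1 x.2) x := by
  have h1 : ContDiffAt ℝ k (fun x : (Fin n → ℝ) × (Fin n → ℝ) => b.legendreInv x.1) x :=
    ContDiffAt.comp (g := b.legendreInv) (f := Prod.fst) x (b.contDiffAt_legendreInv hx) contDiffAt_fst
  have h2 : dotL n x.1 x.1 ≠ 0 := dotL_self_ne hx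
  unfold extVelocity tangentPart
  fun_prop (disch := assumption)

theorem contDiffAt_extField {k : WithTop ℕ∞} {x : (Fin n → ℝ) × (Fin n → ℝ)} (hx : x.1 ≠ 0) :
    ContDiffAt ℝ k b.extField x := by
  have h1 := b.contDiffAt_extVelocity (k := k) hx
  have h2 : dotL n x.1 x.1 ≠ 0 := dotL_self_ne hx
  unfold extField extForceOf
  fun_prop (disch := assumption)

theorem dot_tangentPart {γ : Fin n → ℝ} (hγ : γ ≠ 0) (p : Fin n → ℝ) :
    γ ⬝ᵥ tangentPart γ p = 0 := by
  have h := dotL_self_ne hγ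
  simp only [dotL_apply] at h
  simp [tangentPart, dotProduct_sub, h]

/-- The implicit equation for the velocity. Being valid for every `γ ≠ 0`, it can be differentiated
in all directions, which avoids differentiating the inverse operator. -/
theorem legendreOp_extVelocity {γ : Fin n → ℝ} (hγ : γ ≠ 0) (p : Fin n → ℝ) :
    b.legendreOp γ (b.extVelocity γ p) = b.ε ^ 2 • tangentPart γ p := by
  rw [extVelocity, map_smul, b.legendreOp_inv hγ]

theorem dot_extVelocity {γ : Fin n → ℝ} (hγ : γ ≠ 0) (p : Fin n → ℝ) :
    γ ⬝ᵥ b.extVelocity γ p = 0 := by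
  have h := b.dot_legendreOp γ (b.extVelocity γ p)
  rw [b.legendreOp_extVelocity hγ, dotProduct_smul, dot_tangentPart hγ, smul_zero] at h
  exact (mul_eq_zero.1 h.symm).resolve_right (dotL_self_ne hγ)

/-- The coefficient of `γ` in the force is divided by `(γ, γ)` precisely so that `(γ, p)` is
conserved off the cotangent bundle too. -/
theorem extField_dot_snd {x : (Fin n → ℝ) × (Fin n → ℝ)} (hx : x.1 ≠ 0) :
    (b.extField x).1 ⬝ᵥ x.2 + x.1 ⬝ᵥ (b.extField x).2 = 0 := by
  have h := dotL_self_ne hx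
  simp only [extField, extForceOf, dotProduct_sub, dotProduct_smul, dotL_apply, smul_eq_mul] at *
  field_simp
  ring

theorem extVelocity_eq {γ p : Fin n → ℝ} (hγ : γ ⬝ᵥ γ = 1) (hp : γ ⬝ᵥ p = 0) :
    b.extVelocity γ p = b.velocity γ p := by
  have h0 := ne_zero_of_unit hγ
  have h1 := b.velocity_spec hγ hp
  have h2 := b.dot_extVelocity h0 p
  refine (b.legendre_bijOn hγ).injOn h2 h1.1 ?_
  rw [h1.2]
  have h3 := b.legendreOp_extVelocity h0 p
  rw [legendreOp_apply, h2, zero_smul, add_zero, b.tensor_swap] at h3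
  have hε := b.ε_ne
  have h4 : b.legendre γ (b.extVelocity γ p)
      = -(1 / b.ε ^ 2) • b.tensor γ (b.extVelocity γ p) γ := rfl
  rw [h4, neg_smul, ← smul_neg, h3, smul_smul]
  simp [tangentPart, hp, hε]

theorem extField_eq {x : (Fin n → ℝ) × (Fin n → ℝ)} (hx : x ∈ cotangentSphere n) :
    b.extField x = b.field x := by
  refine Prod.ext (b.extVelocity_eq hx.1 hx.2) ?_
  have h := hx.1
  simp only [extField, field, force, extForceOf, b.extVelocity_eq hx.1 hx.2, dotL_apply, h, div_one,
    tensor_apply]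
  rw [sub_eq_add_neg, ← neg_smul]
  congr 2
  rw [dotProduct_comm x.1]
  ring

/-! ### The divergence of the extended field -/

/-- The derivative of `legendreOp` at `γ` in the direction `v`. -/
noncomputable def legendreOpDeriv (γ v : Fin n → ℝ) : (Fin n → ℝ) →L[ℝ] (Fin n → ℝ) :=
  b.legendreForm v γ + b.legendreForm γ v

theorem hasDerivWithinAt_clm {F G : Type*} [NormedAddCommGroup F] [NormedSpace ℝ F]
    [NormedAddCommGroup G] [NormedSpace ℝ G] (L : F →L[ℝ] G) {g : ℝ → F} {g' : F} {s : Set ℝ}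
    {t : ℝ} (hg : HasDerivWithinAt g g' s t) :
    HasDerivWithinAt (fun u => L (g u)) (L g') s t :=
  L.hasFDerivAt.comp_hasDerivWithinAt t hg

theorem hasDerivAt_clm {F G : Type*} [NormedAddCommGroup F] [NormedSpace ℝ F]
    [NormedAddCommGroup G] [NormedSpace ℝ G] (L : F →L[ℝ] G) {g : ℝ → F} {g' : F}
    {t : ℝ} (hg : HasDerivAt g g' t) :
    HasDerivAt (fun u => L (g u)) (L g') t :=
  L.hasFDerivAt.comp_hasDerivAt t hg

theorem hasDerivWithinAt_legendreOp {g : ℝ → Fin n → ℝ} {g' : Fin n → ℝ} {s : Set ℝ} {t : ℝ}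
    (hg : HasDerivWithinAt g g' s t) :
    HasDerivWithinAt (fun u => b.legendreOp (g u)) (b.legendreOpDeriv (g t) g') s t := by
  have h : HasDerivWithinAt (fun u => b.legendreForm (g u)) (b.legendreForm g') s t :=
    hasDerivWithinAt_clm (G := (Fin n → ℝ) →L[ℝ] (Fin n → ℝ) →L[ℝ] (Fin n → ℝ)) b.legendreForm hg
  exact h.clm_apply hg

/-- The common trace in the divergence of the extended field and in the logarithmic derivative of
`det (legendreOp γ)`. -/
noncomputable def tensorTrace (γ v : Fin n → ℝ) : ℝ :=
  tr ((b.legendreInv γ).comp ((b.tensor v).flip γ))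

theorem tr_inv_tensor {γ : Fin n → ℝ} (hγ : γ ≠ 0) (v w : Fin n → ℝ) :
    tr ((b.legendreInv γ).comp (b.tensor v w)) = 0 :=
  tr_symm_comp_skew (b.legendreInv_symm hγ) fun x y => b.tensor_skew v w y x

/-- The operators under the two traces are adjoint to each other, by the pair symmetry and the two
skew-symmetries of the tensor. -/
theorem tr_tensor_inv {γ : Fin n → ℝ} (hγ : γ ≠ 0) (v : Fin n → ℝ) :
    tr (((b.tensor γ).flip v).comp (b.legendreInv γ)) = b.tensorTrace γ v :=
  tr_eq_of_adjoint fun x y => by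
    simp only [ContinuousLinearMap.comp_apply, ContinuousLinearMap.flip_apply]
    rw [b.legendreInv_symm hγ, dotProduct_comm (b.tensor v x γ), b.tensor_pair,
      b.tensor_skew, b.tensor_swap x v, dotProduct_neg, neg_neg]

/-- This is the logarithmic derivative of `det (legendreOp γ)` in the direction `v`. The derivative
has two tensor terms, each contributing `-tensorTrace`, and two rank-one terms, whose traces vanish
since the inverse is symmetric, fixes `γ`, and `v` is orthogonal to `γ`. -/
theorem tr_legendreOpDeriv_inv {γ v : Fin n → ℝ} (hγ : γ ⬝ᵥ γ = 1) (hv : γ ⬝ᵥ v = 0) :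
    tr ((b.legendreOpDeriv γ v).comp (b.legendreInv γ)) = -2 * b.tensorTrace γ v := by
  have h0 := ne_zero_of_unit hγ
  have e : b.legendreOpDeriv γ v = -(b.tensor v).flip γ + -(b.tensor γ).flip v
      + ((dotL n v).smulRight γ + (dotL n γ).smulRight v) := by
    refine ContinuousLinearMap.ext fun δ => ?_
    simp only [legendreOpDeriv, _root_.add_apply, _root_.neg_apply, legendreForm_apply,
      ContinuousLinearMap.flip_apply, ContinuousLinearMap.smulRight_apply, dotL_apply]
    rw [b.tensor_swap δ v, b.tensor_swap δ γ]
    abel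
  have h1 : ∀ x y, tr (((dotL n x).smulRight y).comp (b.legendreInv γ))
      = x ⬝ᵥ b.legendreInv γ y := fun x y => by
    rw [tr_comp_comm]
    have : (b.legendreInv γ).comp ((dotL n x).smulRight y)
        = (dotL n x).smulRight (b.legendreInv γ y) := by
      refine ContinuousLinearMap.ext fun δ => ?_
      simp
    rw [this, tr_smulRight, dotL_apply]
  rw [e, ContinuousLinearMap.add_comp, ContinuousLinearMap.add_comp, ContinuousLinearMap.add_comp,
    ContinuousLinearMap.neg_comp, ContinuousLinearMap.neg_comp, tr_add, tr_add, tr_add, tr_neg,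
    tr_neg, h1, h1, b.legendreInv_symm h0 γ v, b.legendreInv_self hγ, dotProduct_comm v, hv,
    b.tr_tensor_inv h0, tr_comp_comm, tensorTrace]
  ring

theorem hasFDerivAt_extField {x : (Fin n → ℝ) × (Fin n → ℝ)} (hx : x.1 ≠ 0) :
    HasFDerivAt b.extField (fderiv ℝ b.extField x) x :=
  ((b.contDiffAt_extField (k := 1) hx).differentiableAt one_ne_zero).hasFDerivAt

/-- Differentiating `legendreOp_extVelocity` in `γ` and solving for the derivative of the velocity
leaves three kinds of terms: the operator of `tensorTrace`, a symmetric times a skew operator, and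
rank-one operators with image along `γ`. The last have trace zero because `v` and `p` are orthogonal
to `γ`. -/
theorem tr_extVelocity_deriv {x : (Fin n → ℝ) × (Fin n → ℝ)} (hx : x ∈ cotangentSphere n) :
    tr ((ContinuousLinearMap.fst ℝ _ _).comp ((fderiv ℝ b.extField x).comp
      (ContinuousLinearMap.inl ℝ _ _))) = -b.tensorTrace x.1 (b.extVelocity x.1 x.2) := by
  obtain ⟨γ, p⟩ := x
  obtain ⟨hγ, hp⟩ : γ ⬝ᵥ γ = 1 ∧ γ ⬝ᵥ p = 0 := hx
  have h0 := ne_zero_of_unit hγ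
  set v := b.extVelocity γ p with hv
  have hγv : γ ⬝ᵥ v = 0 := b.dot_extVelocity h0 p
  have e : (ContinuousLinearMap.fst ℝ _ _).comp ((fderiv ℝ b.extField (γ, p)).comp
      (ContinuousLinearMap.inl ℝ _ _)) = -((b.legendreInv γ).comp ((b.tensor v).flip γ)
        + (b.legendreInv γ).comp (b.tensor v γ)
        + ((dotL n v).smulRight γ + b.ε ^ 2 • (dotL n p).smulRight γ)) := by
    refine ContinuousLinearMap.ext fun δ => ?_
    set w : Fin n → ℝ := ((fderiv ℝ b.extField (γ, p)) (δ, 0)).1 with hw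
    have hline : HasDerivAt (fun s : ℝ => γ + s • δ) δ 0 := by
      simpa using ((hasDerivAt_id (0 : ℝ)).smul_const δ).const_add γ
    have h1 : HasDerivAt (fun s : ℝ => b.extVelocity (γ + s • δ) p) w 0 := by
      have h2 : HasDerivAt (fun s : ℝ => (γ + s • δ, p)) (δ, (0 : Fin n → ℝ)) 0 :=
        hline.prodMk (hasDerivAt_const 0 p)
      have h3 := (b.hasFDerivAt_extField (x := (γ + (0 : ℝ) • δ, p)) (by simpa using h0)).comp_hasDerivAt
        (0 : ℝ) h2
      simp only [zero_smul, add_zero] at h3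
      exact hasDerivAt_clm (ContinuousLinearMap.fst ℝ (Fin n → ℝ) (Fin n → ℝ)) h3
    have h5 : HasDerivAt (fun s : ℝ => b.legendreOp (γ + s • δ) (b.extVelocity (γ + s • δ) p))
        (b.legendreOpDeriv γ δ v + b.legendreOp γ w) 0 := by
      have := (hasDerivWithinAt_univ.1 (b.hasDerivWithinAt_legendreOp
        (hasDerivWithinAt_univ.2 hline))).clm_apply h1
      simpa only [zero_smul, add_zero] using this
    have h6 : HasDerivAt (fun s : ℝ => b.ε ^ 2 • tangentPart (γ + s • δ) p)
        (-(b.ε ^ 2 * (δ ⬝ᵥ p)) • γ) 0 := by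
      have ha : HasDerivAt (fun s : ℝ => dotL n (γ + s • δ) p) (δ ⬝ᵥ p) 0 :=
        hasDerivAt_clm ((dotL n).flip p) hline
      have hb : HasDerivAt (fun s : ℝ => dotL n (γ + s • δ) (γ + s • δ))
          (dotL n δ γ + dotL n γ δ) 0 := by
        have h7 : HasDerivAt (fun s : ℝ => dotL n (γ + s • δ)) (dotL n δ) 0 :=
          hasDerivAt_clm (dotL n) hline
        simpa only [zero_smul, add_zero] using h7.clm_apply hline
      have hc := (((ha.div hb (by simp [hγ])).smul hline).const_sub p).const_smul (b.ε ^ 2)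
      refine hc.congr_deriv ?_
      simp [hγ, hp, smul_smul]
    -- Both sides are derivatives at zero of the two members of the implicit equation, which agree
    -- as long as the line avoids the origin.
    have h8 : b.legendreOpDeriv γ δ v + b.legendreOp γ w = -(b.ε ^ 2 * (δ ⬝ᵥ p)) • γ := by
      refine h5.unique (h6.congr_of_eventuallyEq ?_)
      have : ∀ᶠ s : ℝ in nhds 0, γ + s • δ ≠ 0 :=
        hline.continuousAt.eventually_ne (by simpa using h0)
      filter_upwards [this] with s hs
      exact b.legendreOp_extVelocity hs p
    have h9 := congrArg (b.legendreInv γ) h8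
    rw [map_add, b.legendreInv_op h0, map_smul, b.legendreInv_self hγ] at h9
    have h10 : b.legendreOpDeriv γ δ v = b.tensor v δ γ + (δ ⬝ᵥ v) • γ + b.tensor v γ δ := by
      simp [legendreOpDeriv, legendreForm_apply, hγv]
    rw [h10, map_add, map_add, map_smul, b.legendreInv_self hγ] at h9
    have h11 := eq_sub_of_add_eq' h9
    simp only [ContinuousLinearMap.comp_apply, ContinuousLinearMap.coe_fst',
      ContinuousLinearMap.inl_apply, _root_.add_apply, _root_.neg_apply, _root_.smul_apply,
      ContinuousLinearMap.flip_apply, ContinuousLinearMap.smulRight_apply, dotL_apply]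
    rw [← hw, h11, dotProduct_comm δ v, dotProduct_comm δ p, neg_smul, mul_smul]
    abel
  rw [e, tr_neg, tr_add, tr_add, tr_add, tr_smul, tr_smulRight, tr_smulRight, b.tr_inv_tensor h0,
    dotL_apply, dotL_apply, dotProduct_comm v, hγv, dotProduct_comm p, hp, tensorTrace]
  ring

/-- For a fixed unit `γ` the velocity is linear in `p`, given by `W`, which kills `γ`. Of the two
terms in the derivative of `𝐈(γ ∧ v) v`, one has trace `ε² · tensorTrace` and the other is
traceless, being essentially skew times symmetric. The part of the force along `γ` adds the rank-one
trace `l γ`, which is zero. -/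
theorem tr_extForce_deriv {x : (Fin n → ℝ) × (Fin n → ℝ)} (hx : x ∈ cotangentSphere n) :
    tr ((ContinuousLinearMap.snd ℝ _ _).comp ((fderiv ℝ b.extField x).comp
      (ContinuousLinearMap.inr ℝ _ _)))
      = (1 - b.ε) / b.ε * b.tensorTrace x.1 (b.extVelocity x.1 x.2) := by
  obtain ⟨γ, p⟩ := x
  obtain ⟨hγ, hp⟩ : γ ⬝ᵥ γ = 1 ∧ γ ⬝ᵥ p = 0 := hx
  have h0 := ne_zero_of_unit hγ
  set v := b.extVelocity γ p with hv
  set c := (1 - b.ε) / b.ε ^ 3 with hc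
  have hγv : γ ⬝ᵥ v = 0 := b.dot_extVelocity h0 p
  let W : (Fin n → ℝ) →L[ℝ] (Fin n → ℝ) :=
    b.ε ^ 2 • (b.legendreInv γ - (dotL n γ).smulRight γ)
  have hWγ : W γ = 0 := by simp [W, b.legendreInv_self hγ, hγ]
  have hW : ∀ q, b.extVelocity γ q = W q := fun q => by
    simp [W, extVelocity, tangentPart, hγ, map_sub, b.legendreInv_self hγ]
  let Q : (Fin n → ℝ) →L[ℝ] (Fin n → ℝ) := ((b.tensor γ).flip v).comp W + (b.tensor γ v).comp W
  let l : (Fin n → ℝ) →L[ℝ] ℝ := dotL n v + (dotL n p).comp W + c • (dotL n γ).comp Q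
  have e : (ContinuousLinearMap.snd ℝ _ _).comp ((fderiv ℝ b.extField (γ, p)).comp
      (ContinuousLinearMap.inr ℝ _ _)) = c • Q - l.smulRight γ := by
    refine ContinuousLinearMap.ext fun δ => ?_
    have hline : HasDerivAt (fun s : ℝ => p + s • δ) δ 0 := by
      simpa using ((hasDerivAt_id (0 : ℝ)).smul_const δ).const_add p
    have h1 : HasDerivAt (fun s : ℝ => b.extForceOf γ (p + s • δ) (b.extVelocity γ (p + s • δ)))
        ((fderiv ℝ b.extField (γ, p)) (0, δ)).2 0 := by
      have h2 : HasDerivAt (fun s : ℝ => (γ, p + s • δ)) ((0 : Fin n → ℝ), δ) 0 :=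
        (hasDerivAt_const 0 γ).prodMk hline
      have h3 := (b.hasFDerivAt_extField (x := (γ, p + (0 : ℝ) • δ)) (by simpa using h0)).comp_hasDerivAt
        (0 : ℝ) h2
      simp only [zero_smul, add_zero] at h3
      exact hasDerivAt_clm (ContinuousLinearMap.snd ℝ (Fin n → ℝ) (Fin n → ℝ)) h3
    have h5 : HasDerivAt (fun s : ℝ => b.extVelocity γ (p + s • δ)) (W δ) 0 := by
      simp only [hW]
      exact hasDerivAt_clm W hline
    have h6 : HasDerivAt (fun s : ℝ => b.tensor γ (b.extVelocity γ (p + s • δ))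
        (b.extVelocity γ (p + s • δ))) (Q δ) 0 := by
      have h7 := (hasDerivAt_clm (b.tensor γ) h5).clm_apply h5
      simp only [zero_smul, add_zero] at h7
      exact h7
    have h7 : HasDerivAt (fun s : ℝ => dotL n (b.extVelocity γ (p + s • δ)) (p + s • δ))
        (dotL n (W δ) p + dotL n v δ) 0 := by
      have h8 := (hasDerivAt_clm (dotL n) h5).clm_apply hline
      simpa only [zero_smul, add_zero] using h8
    have h8 := (h6.const_smul c).sub (((h7.add
      ((hasDerivAt_clm (dotL n γ) h6).const_mul c)).div_const
        (dotL n γ γ)).smul_const γ)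
    have h9 := h1.unique h8
    simp only [ContinuousLinearMap.comp_apply, ContinuousLinearMap.coe_snd',
      ContinuousLinearMap.inr_apply]
    rw [h9]
    simp [l, hγ, dotProduct_comm (W δ) p, add_comm (v ⬝ᵥ δ)]
  have hQγ : Q γ = 0 := by simp [Q, hWγ]
  -- The correction `(γ, Z γ)` comes from removing the `γ`-direction in `W`. It vanishes for both
  -- operators `Z` used below.
  have h1 : ∀ Z : (Fin n → ℝ) →L[ℝ] (Fin n → ℝ), tr (Z.comp W)
      = b.ε ^ 2 * (tr (Z.comp (b.legendreInv γ)) - γ ⬝ᵥ Z γ) := fun Z => by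
    have : Z.comp W = b.ε ^ 2 • (Z.comp (b.legendreInv γ) - (dotL n γ).smulRight (Z γ)) := by
      refine ContinuousLinearMap.ext fun δ => ?_
      simp [W]
    rw [this, tr_smul, tr_sub, tr_smulRight, dotL_apply]
  have hl : l γ = 0 := by simp [l, hWγ, hQγ, dotProduct_comm v, hγv]
  rw [e, tr_sub, tr_smul, tr_smulRight, hl, tr_add, h1, h1, b.tr_tensor_inv h0,
    tr_comp_comm (b.tensor γ v), b.tr_inv_tensor h0]
  have := b.ε_ne
  simp only [ContinuousLinearMap.flip_apply, tensor_self, dotProduct_zero, dot_tensor_self, hc]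
  field_simp
  ring

theorem tr_fderiv_extField {x : (Fin n → ℝ) × (Fin n → ℝ)} (hx : x ∈ cotangentSphere n) :
    tr (fderiv ℝ b.extField x) = (1 / b.ε - 2) * b.tensorTrace x.1 (b.extVelocity x.1 x.2) := by
  rw [tr_prod, tr_extVelocity_deriv b hx, tr_extForce_deriv b hx]
  have := b.ε_ne
  field_simp
  ring

end Ball

/-! ### Determinants and alternating forms -/

section Determinant

variable {V W : Type*} [AddCommGroup V] [Module ℝ V] [AddCommGroup W] [Module ℝ W]

theorem ker_le_comap {l : V →ₗ[ℝ] W} {f : V →ₗ[ℝ] V} (h : l ∘ₗ f = l) :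
    LinearMap.ker l ≤ (LinearMap.ker l).comap f := fun v hv => by
  have := LinearMap.congr_fun h v
  simp only [LinearMap.mem_ker, Submodule.mem_comap, LinearMap.comp_apply] at *
  rw [this, hv]

variable [FiniteDimensional ℝ V]

/-- If `f` preserves the linear map `l`, then its determinant is that of its restriction to the
kernel of `l`. -/
theorem det_eq_det_restrict_ker {l : V →ₗ[ℝ] W} {f : V →ₗ[ℝ] V} (h : l ∘ₗ f = l) :
    LinearMap.det f = LinearMap.det (f.restrict (ker_le_comap h)) := by
  have hQ : (LinearMap.ker l).mapQ (LinearMap.ker l) f (ker_le_comap h) = LinearMap.id := by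
    refine Submodule.linearMap_qext _ (LinearMap.ext fun v => ?_)
    have := LinearMap.congr_fun h v
    simp only [LinearMap.comp_apply] at this
    simp only [LinearMap.comp_apply, Submodule.mkQ_apply, Submodule.mapQ_apply, LinearMap.id_apply]
    rw [Submodule.Quotient.eq, LinearMap.mem_ker, map_sub, this, sub_self]
  rw [LinearMap.det_eq_det_mul_det (LinearMap.ker l) f (ker_le_comap h), hQ, LinearMap.det_id,
    mul_one]

/-- An operator acts on alternating forms of top degree by its determinant. -/
theorem alternating_comp_eq_det_mul {ι : Type*} [Fintype ι] [DecidableEq ι]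
    (hι : Fintype.card ι = Module.finrank ℝ V) (g : V [⋀^ι]→ₗ[ℝ] ℝ) (f : V →ₗ[ℝ] V) (v : ι → V) :
    g (fun i => f (v i)) = LinearMap.det f * g v := by
  let e : Module.Basis ι ℝ V := (Module.finBasisOfFinrankEq ℝ V hι.symm).reindex
    (Fintype.equivFin ι).symm
  have h := e.det_comp f v
  rw [g.eq_smul_basis_det e]
  simp only [AlternatingMap.smul_apply, smul_eq_mul]
  rw [show (fun i => f (v i)) = f ∘ v from rfl, h]
  ring

end Determinant

/-! ### The power of the symplectic form as an alternating map -/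

section SymplecticPower

variable {n : ℕ}

theorem sympl_add_left (u u' v : (Fin n → ℝ) × (Fin n → ℝ)) :
    sympl (u + u') v = sympl u v + sympl u' v := by
  simp [sympl]; ring

theorem sympl_add_right (u v v' : (Fin n → ℝ) × (Fin n → ℝ)) :
    sympl u (v + v') = sympl u v + sympl u v' := by
  simp [sympl]; ring

theorem sympl_smul_left (c : ℝ) (u v : (Fin n → ℝ) × (Fin n → ℝ)) :
    sympl (c • u) v = c * sympl u v := by
  simp [sympl]; ring

theorem sympl_smul_right (c : ℝ) (u v : (Fin n → ℝ) × (Fin n → ℝ)) :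
    sympl u (c • v) = c * sympl u v := by
  simp [sympl]; ring

/-- Each slot occurs in exactly one factor, so multilinearity of the product reduces to bilinearity
of `sympl`. -/
theorem prod_sympl_update {k : ℕ} [DecidableEq (Fin k × Fin 2)]
    (v : Fin k × Fin 2 → (Fin n → ℝ) × (Fin n → ℝ)) (c : Fin k × Fin 2)
    (x : (Fin n → ℝ) × (Fin n → ℝ)) :
    ∏ i, sympl (Function.update v c x (i, 0)) (Function.update v c x (i, 1))
      = (if c.2 = 0 then sympl x (v (c.1, 1)) else sympl (v (c.1, 0)) x)
        * ∏ i ∈ Finset.univ.erase c.1, sympl (v (i, 0)) (v (i, 1)) := by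
  rw [← Finset.mul_prod_erase _ _ (Finset.mem_univ c.1)]
  congr 1
  · obtain ⟨i, j⟩ := c
    fin_cases j <;> simp
  · refine Finset.prod_congr rfl fun i hi => ?_
    have h := Finset.ne_of_mem_erase hi
    have h' : ∀ j, (i, j) ≠ c := fun j hj => h (by rw [← hj])
    rw [Function.update_of_ne (h' 0), Function.update_of_ne (h' 1)]

/-- The product of the values of the symplectic form on consecutive pairs. -/
noncomputable def symplProd (n k : ℕ) :
    MultilinearMap ℝ (fun _ : Fin k × Fin 2 => (Fin n → ℝ) × (Fin n → ℝ)) ℝ where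
  toFun v := ∏ i, sympl (v (i, 0)) (v (i, 1))
  map_update_add' v c x y := by
    simp only [prod_sympl_update, sympl_add_left, sympl_add_right]
    split_ifs <;> ring
  map_update_smul' v c r x := by
    simp only [prod_sympl_update, sympl_smul_left, sympl_smul_right, smul_eq_mul]
    split_ifs <;> ring

/-- The alternating form `w ^ k`. -/
noncomputable def symplForm (n k : ℕ) :
    ((Fin n → ℝ) × (Fin n → ℝ)) [⋀^Fin k × Fin 2]→ₗ[ℝ] ℝ :=
  (1 / 2 ^ k : ℝ) • MultilinearMap.alternatization (symplProd n k)

theorem symplForm_apply {k : ℕ} (v : Fin k × Fin 2 → (Fin n → ℝ) × (Fin n → ℝ)) :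
    symplForm n k v = symplPow k v := by
  rw [symplForm, symplPow, AlternatingMap.smul_apply, smul_eq_mul,
    MultilinearMap.alternatization_apply]
  congr 1
  refine Finset.sum_congr rfl fun s _ => ?_
  rw [Units.smul_def, zsmul_eq_mul]
  rfl

theorem symplPow_congr {k : ℕ} {v v' : Fin k × Fin 2 → (Fin n → ℝ) × (Fin n → ℝ)}
    (h : ∀ i j, sympl (v i) (v j) = sympl (v' i) (v' j)) : symplPow k v = symplPow k v' := by
  simp only [symplPow, h]

/-! ### Tangent spaces of the cotangent bundle -/

/-- The differential at `x = (γ, p)` of the map `(½ (γ, γ), (γ, p))`. -/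
noncomputable def constraintDeriv (x : (Fin n → ℝ) × (Fin n → ℝ)) :
    (Fin n → ℝ) × (Fin n → ℝ) →L[ℝ] ℝ × ℝ :=
  ((dotL n x.1).comp (ContinuousLinearMap.fst ℝ _ _)).prod
    ((dotL n x.2).comp (ContinuousLinearMap.fst ℝ _ _)
      + (dotL n x.1).comp (ContinuousLinearMap.snd ℝ _ _))

theorem constraintDeriv_apply (x u : (Fin n → ℝ) × (Fin n → ℝ)) :
    constraintDeriv x u = (x.1 ⬝ᵥ u.1, x.2 ⬝ᵥ u.1 + x.1 ⬝ᵥ u.2) := rfl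

/-- The vectors `(a γ, c γ)` show that the differential of the constraints is onto, so the tangent
space has dimension `2n - 2` and `w^{n-1}` is of top degree on it. The truncated subtraction is
harmless: a point `x` exists only for `n ≥ 1`. -/
theorem finrank_ker_constraintDeriv {x : (Fin n → ℝ) × (Fin n → ℝ)} (hx : x ∈ cotangentSphere n) :
    Fintype.card (Fin (n - 1) × Fin 2) = Module.finrank ℝ
      (LinearMap.ker (constraintDeriv x : (Fin n → ℝ) × (Fin n → ℝ) →ₗ[ℝ] ℝ × ℝ)) := by
  obtain ⟨h1, h2⟩ := hx
  have hr : LinearMap.range (constraintDeriv x : (Fin n → ℝ) × (Fin n → ℝ) →ₗ[ℝ] ℝ × ℝ) = ⊤ := by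
    rw [LinearMap.range_eq_top]
    rintro ⟨a, c⟩
    refine ⟨(a • x.1, c • x.1), ?_⟩
    simp [constraintDeriv_apply, h1, dotProduct_comm x.2, h2]
  have h := LinearMap.finrank_range_add_finrank_ker
    (constraintDeriv x : (Fin n → ℝ) × (Fin n → ℝ) →ₗ[ℝ] ℝ × ℝ)
  rw [hr, finrank_top] at h
  simp only [Module.finrank_prod, Module.finrank_self, Module.finrank_fin_fun] at h
  simp only [Fintype.card_prod, Fintype.card_fin]
  omega

/-- The reflection of `ℝⁿ` in the hyperplane orthogonal to `w`. -/
noncomputable def reflect (w : Fin n → ℝ) : (Fin n → ℝ) →L[ℝ] (Fin n → ℝ) :=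
  ContinuousLinearMap.id ℝ _ - (2 / (w ⬝ᵥ w)) • (dotL n w).smulRight w

theorem reflect_apply (w a : Fin n → ℝ) : reflect w a = a - (2 / (w ⬝ᵥ w) * (w ⬝ᵥ a)) • w := by
  simp [reflect, smul_smul]

theorem reflect_reflect (w a : Fin n → ℝ) : reflect w (reflect w a) = a := by
  by_cases hw : w = 0
  · simp [reflect_apply, hw]
  · have h : w ⬝ᵥ w ≠ 0 := fun h => hw (dotProduct_self_eq_zero.1 h)
    rw [reflect_apply, reflect_apply, sub_sub, ← add_smul]
    have : 2 / (w ⬝ᵥ w) * (w ⬝ᵥ a)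
        + 2 / (w ⬝ᵥ w) * (w ⬝ᵥ (a - (2 / (w ⬝ᵥ w) * (w ⬝ᵥ a)) • w)) = 0 := by
      simp only [dotProduct_sub, dotProduct_smul, smul_eq_mul]
      field_simp
      ring
    rw [this, zero_smul, sub_zero]

theorem reflect_symm (w a c : Fin n → ℝ) : a ⬝ᵥ reflect w c = reflect w a ⬝ᵥ c := by
  simp only [reflect_apply, dotProduct_sub, sub_dotProduct, dotProduct_smul, smul_dotProduct,
    smul_eq_mul, dotProduct_comm a w]
  ring

theorem reflect_dot (w a c : Fin n → ℝ) : reflect w a ⬝ᵥ reflect w c = a ⬝ᵥ c := by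
  rw [← reflect_symm, reflect_reflect]

theorem reflect_sub {a c : Fin n → ℝ} (ha : a ⬝ᵥ a = 1) (hc : c ⬝ᵥ c = 1) :
    reflect (a - c) a = c := by
  by_cases h : a - c = 0
  · rw [h, sub_eq_zero.1 h]; simp [reflect_apply]
  · have h' : (a - c) ⬝ᵥ (a - c) ≠ 0 := fun h0 => h (dotProduct_self_eq_zero.1 h0)
    have h2 : (a - c) ⬝ᵥ (a - c) = 2 * ((a - c) ⬝ᵥ a) := by
      simp only [sub_dotProduct, dotProduct_sub, ha, hc, dotProduct_comm c a]; ring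
    have h3 : 2 / ((a - c) ⬝ᵥ (a - c)) * ((a - c) ⬝ᵥ a) = 1 := by
      rw [div_mul_eq_mul_div, ← h2, div_self h']
    rw [reflect_apply, h3, one_smul, sub_sub_cancel]

/-- The group of linear symplectic maps acts transitively on the tangent spaces of the cotangent
bundle of the sphere. -/
theorem exists_symplectic {x y : (Fin n → ℝ) × (Fin n → ℝ)} (hx : x ∈ cotangentSphere n)
    (hy : y ∈ cotangentSphere n) :
    ∃ S : (Fin n → ℝ) × (Fin n → ℝ) →ₗ[ℝ] (Fin n → ℝ) × (Fin n → ℝ),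
      (∀ u v, sympl (S u) (S v) = sympl u v) ∧ LinearMap.det S = 1 ∧
      (constraintDeriv x : (Fin n → ℝ) × (Fin n → ℝ) →ₗ[ℝ] ℝ × ℝ) ∘ₗ S = constraintDeriv y := by
  obtain ⟨γ, p⟩ := x
  obtain ⟨γ', p'⟩ := y
  obtain ⟨h1, h2⟩ : γ ⬝ᵥ γ = 1 ∧ γ ⬝ᵥ p = 0 := hx
  obtain ⟨h1', h2'⟩ : γ' ⬝ᵥ γ' = 1 ∧ γ' ⬝ᵥ p' = 0 := hy
  -- The reflection takes `γ'` to `γ`; what remains is the discrepancy `d` between the image of `p'`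
  -- and `p`.
  let R : (Fin n → ℝ) →ₗ[ℝ] (Fin n → ℝ) := reflect (γ' - γ)
  have hR : ∀ a, R a = reflect (γ' - γ) a := fun _ => rfl
  have hRR : ∀ a c, R a ⬝ᵥ R c = a ⬝ᵥ c := reflect_dot _
  have hRγ : R γ' = γ := reflect_sub h1' h1
  let d : Fin n → ℝ := R p' - p
  have hd : γ ⬝ᵥ d = 0 := by
    simp only [d, dotProduct_sub, h2]
    rw [← hRγ, hRR, h2', sub_zero]
  -- A shear by a symmetric operator is symplectic and unipotent. This one satisfies `(γ, Q a) = (d,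
  -- a)`, since `γ` is a unit vector orthogonal to `d`, and so corrects the momentum in the second
  -- constraint.
  let Q : (Fin n → ℝ) →ₗ[ℝ] (Fin n → ℝ) :=
    ((dotL n d).smulRight γ + (dotL n γ).smulRight d : (Fin n → ℝ) →L[ℝ] (Fin n → ℝ))
  have hQ : ∀ a, Q a = (d ⬝ᵥ a) • γ + (γ ⬝ᵥ a) • d := fun a => rfl
  let Sh : (Fin n → ℝ) × (Fin n → ℝ) →ₗ[ℝ] (Fin n → ℝ) × (Fin n → ℝ) :=
    (LinearMap.fst ℝ _ _).prod (LinearMap.snd ℝ _ _ + Q ∘ₗ LinearMap.fst ℝ _ _)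
  have hSh : ∀ u, Sh u = (u.1, u.2 + Q u.1) := fun u => rfl
  have hdetR : LinearMap.det (LinearMap.prodMap R R) = 1 := by
    rw [LinearMap.det_prodMap, ← LinearMap.det_comp]
    have : R ∘ₗ R = LinearMap.id := LinearMap.ext fun a => reflect_reflect _ a
    rw [this, LinearMap.det_id]
  have hdetSh : LinearMap.det Sh = 1 := by
    have hf : LinearMap.fst ℝ (Fin n → ℝ) (Fin n → ℝ) ∘ₗ Sh = LinearMap.fst ℝ _ _ := rfl
    rw [det_eq_det_restrict_ker hf]
    have : Sh.restrict (ker_le_comap hf) = LinearMap.id := by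
      refine LinearMap.ext fun u => Subtype.ext ?_
      have hu : u.1.1 = 0 := u.2
      rw [LinearMap.coe_restrict_apply, hSh, hu]
      ext <;> simp [hu]
    rw [this, LinearMap.det_id]
  refine ⟨Sh ∘ₗ LinearMap.prodMap R R, fun u v => ?_, ?_, ?_⟩
  · simp only [LinearMap.comp_apply, LinearMap.prodMap_apply, hSh, sympl, add_dotProduct, hRR, hQ,
      smul_dotProduct, smul_eq_mul]
    ring
  · rw [LinearMap.det_comp, hdetR, hdetSh, one_mul]
  · refine LinearMap.ext fun u => ?_
    simp only [LinearMap.comp_apply, LinearMap.prodMap_apply, hSh, ContinuousLinearMap.coe_coe,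
      constraintDeriv_apply, hQ, dotProduct_add, dotProduct_smul, h1, hd, smul_eq_mul]
    have e1 : ∀ a, γ ⬝ᵥ R a = γ' ⬝ᵥ a := fun a => by rw [← hRγ, hRR]
    have e2 : d ⬝ᵥ R u.1 = p' ⬝ᵥ u.1 - p ⬝ᵥ R u.1 := by
      simp only [d, sub_dotProduct, hRR]
    rw [e1, e1, e2]
    ext
    · rfl
    · simp only; ring

/-- A linear map between the tangent spaces of the cotangent bundle of the sphere at `x` and `y`
which is induced by an operator intertwining the differentials of the constraints multiplies the
volume form `w ^ (n - 1)` by the determinant of the operator. -/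
theorem symplPow_comp {x y : (Fin n → ℝ) × (Fin n → ℝ)} (hx : x ∈ cotangentSphere n)
    (hy : y ∈ cotangentSphere n)
    {A : (Fin n → ℝ) × (Fin n → ℝ) →ₗ[ℝ] (Fin n → ℝ) × (Fin n → ℝ)}
    (hA : ∀ u, constraintDeriv y (A u) = constraintDeriv x u)
    {v : Fin (n - 1) × Fin 2 → (Fin n → ℝ) × (Fin n → ℝ)} (hv : ∀ a, constraintDeriv x (v a) = 0) :
    symplPow (n - 1) (fun a => A (v a)) = LinearMap.det A * symplPow (n - 1) v := by
  -- Composing with `S` returns to the tangent space at `x` without changing `w` or the determinant.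
  -- The composite preserves the constraint differential, so its determinant on the kernel is its
  -- full determinant.
  obtain ⟨S, hS, hdet, hSc⟩ := exists_symplectic hx hy
  have h1 : (constraintDeriv x : (Fin n → ℝ) × (Fin n → ℝ) →ₗ[ℝ] ℝ × ℝ) ∘ₗ (S ∘ₗ A)
      = constraintDeriv x := by
    rw [← LinearMap.comp_assoc, hSc]
    exact LinearMap.ext hA
  let T := LinearMap.ker (constraintDeriv x : (Fin n → ℝ) × (Fin n → ℝ) →ₗ[ℝ] ℝ × ℝ)
  have h2 := alternating_comp_eq_det_mul (finrank_ker_constraintDeriv hx)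
    ((symplForm n (n - 1)).compLinearMap T.subtype) ((S ∘ₗ A).restrict (ker_le_comap h1))
    (fun a => ⟨v a, hv a⟩)
  rw [← det_eq_det_restrict_ker h1, LinearMap.det_comp, hdet, one_mul] at h2
  rw [← symplForm_apply v]
  refine Eq.trans ?_ h2
  rw [AlternatingMap.compLinearMap_apply, symplForm_apply]
  exact symplPow_congr fun i j => (hS _ _).symm

end SymplecticPower

/-! ### The density -/

namespace Ball

variable {n : ℕ} (b : Ball n)

/-- The determinant of the compression of `𝐈` to `𝔳_γ` is that of the extended Legendre
transformation. -/
theorem det_compression {γ : Fin n → ℝ} (hγ : γ ⬝ᵥ γ = 1) :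
    LinearMap.det (prV γ ∘ₗ b.modInertia ∘ₗ (vSpace γ).subtype)
      = LinearMap.det (b.legendreOp γ : (Fin n → ℝ) →ₗ[ℝ] (Fin n → ℝ)) := by
  have hl : (dotL n γ : (Fin n → ℝ) →ₗ[ℝ] ℝ) ∘ₗ
      (b.legendreOp γ : (Fin n → ℝ) →ₗ[ℝ] (Fin n → ℝ)) = dotL n γ :=
    LinearMap.ext fun v => by
      have := b.dot_legendreOp γ v
      rw [hγ, mul_one] at this
      exact this
  let T := LinearMap.ker (dotL n γ : (Fin n → ℝ) →ₗ[ℝ] ℝ)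
  -- The map `v ↦ v ∧ γ` identifies the complement of `γ` with `𝔳_γ` and conjugates `legendreOp γ`
  -- there to the compression of `𝐈`.
  let e₀ : T →ₗ[ℝ] vSpace γ := (wedgeRight γ).rangeRestrict ∘ₗ T.subtype
  have he : ∀ v : T, (e₀ v).1 = wedge v.1 γ := fun v => rfl
  have hT : ∀ v : T, γ ⬝ᵥ v.1 = 0 := fun v => v.2
  have hbij : Function.Bijective e₀ := by
    constructor
    · rw [← LinearMap.ker_eq_bot, LinearMap.ker_eq_bot']
      intro v hv
      have h1 := wedge_mulVec v.1 γ γ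
      rw [← he, hv, hγ, dotProduct_comm, hT] at h1
      exact Subtype.ext (by simpa using h1.symm)
    · rintro ⟨_, ⟨u, rfl⟩⟩
      refine ⟨⟨u - (γ ⬝ᵥ u) • γ, ?_⟩, Subtype.ext ?_⟩
      · show γ ⬝ᵥ (u - (γ ⬝ᵥ u) • γ) = 0
        simp [dotProduct_sub, hγ]
      · rw [he]
        show wedgeRight γ (u - (γ ⬝ᵥ u) • γ) = wedgeRight γ u
        have h0 : wedgeRight γ γ = 0 := by
          ext i j; simp [wedgeRight]
        rw [map_sub, map_smul, h0, smul_zero, sub_zero]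
  let e := LinearEquiv.ofBijective e₀ hbij
  rw [det_eq_det_restrict_ker hl, ← LinearMap.det_conj _ e]
  congr 1
  refine LinearMap.ext fun z => ?_
  obtain ⟨v, rfl⟩ := e.surjective z
  simp only [LinearMap.comp_apply, LinearEquiv.coe_coe, LinearEquiv.symm_apply_apply]
  refine Subtype.ext ?_
  show wedgeRight γ ((b.modInertia (wedge v.1 γ)).1 *ᵥ γ) = wedgeRight γ (b.legendreOp γ v.1)
  rw [legendreOp_apply, hT, zero_smul, add_zero]
  rfl

theorem density_eq {γ : Fin n → ℝ} (hγ : γ ⬝ᵥ γ = 1) :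
    b.density γ = LinearMap.det (b.legendreOp γ : (Fin n → ℝ) →ₗ[ℝ] (Fin n → ℝ))
      ^ (1 / (2 * b.ε) - 1) := by
  rw [density, b.det_compression hγ]

end Ball

/-! ### A complete flow which follows the reduced equations in a bounded region -/

section Cutoff

variable {n : ℕ}

theorem continuous_dot {X : Type*} [TopologicalSpace X] {f g : X → Fin n → ℝ} (hf : Continuous f)
    (hg : Continuous g) : Continuous fun x => f x ⬝ᵥ g x := by
  have : Continuous fun x => dotL n (f x) (g x) := by fun_prop
  exact this

theorem isClosed_cotangentSphere : IsClosed (cotangentSphere n) :=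
  (isClosed_eq (continuous_dot continuous_fst continuous_fst) continuous_const).inter
    (isClosed_eq (continuous_dot continuous_fst continuous_snd) continuous_const)

/-- The bounded part of the cotangent bundle is compact and avoids `γ = 0`, where `extField` need
not be smooth. The cutoff is one on a neighbourhood, not just at the points, so that truncation
leaves the derivative of the field unchanged there. -/
theorem exists_cutoff (n : ℕ) (R : ℝ) :
    ∃ χ : (Fin n → ℝ) × (Fin n → ℝ) → ℝ, ContDiff ℝ 2 χ ∧ HasCompactSupport χ ∧
      (∀ x ∈ tsupport χ, x.1 ≠ 0) ∧
      ∀ x ∈ cotangentSphere n, ‖x‖ ≤ R → ∀ᶠ y in nhds x, χ y = 1 := by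
  have hK : IsCompact (cotangentSphere n ∩ Metric.closedBall 0 R) :=
    (isCompact_closedBall _ _).inter_left isClosed_cotangentSphere
  have hU : IsOpen {x : (Fin n → ℝ) × (Fin n → ℝ) | x.1 ≠ 0} :=
    isOpen_ne_fun continuous_fst continuous_const
  obtain ⟨K', hK', h1, h2⟩ := exists_compact_between hK hU
    (fun x hx => Ball.ne_zero_of_unit hx.1.1)
  obtain ⟨χ, hχ1, hχ0, -⟩ := exists_contMDiffMap_one_nhds_of_subset_interior (n := 2)
    (modelWithCornersSelf ℝ ((Fin n → ℝ) × (Fin n → ℝ))) hK.isClosed h1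
  refine ⟨χ, χ.contMDiff.contDiff, HasCompactSupport.intro hK' hχ0, fun x hx => ?_,
    fun x hx hR => ?_⟩
  · refine h2 (closure_minimal (fun y hy => ?_) hK'.isClosed hx)
    by_contra hy'
    exact hy (hχ0 y hy')
  · have hm : x ∈ cotangentSphere n ∩ Metric.closedBall 0 R := ⟨hx, by simpa using hR⟩
    exact hχ1.filter_mono (nhds_le_nhdsSet hm)

/-- The map whose level set is the cotangent bundle of the sphere. -/
noncomputable def constraint (x : (Fin n → ℝ) × (Fin n → ℝ)) : ℝ × ℝ :=
  (1 / 2 * (x.1 ⬝ᵥ x.1), x.1 ⬝ᵥ x.2)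

theorem mem_cotangentSphere_iff (x : (Fin n → ℝ) × (Fin n → ℝ)) :
    x ∈ cotangentSphere n ↔ constraint x = (1 / 2, 0) := by
  simp only [cotangentSphere, constraint, mem_ofPred_eq, Prod.mk.injEq]
  refine and_congr_left fun _ => ?_
  constructor <;> intro h <;> linarith

theorem hasFDerivAt_constraint (x : (Fin n → ℝ) × (Fin n → ℝ)) :
    HasFDerivAt constraint (constraintDeriv x) x := by
  have h1 : HasFDerivAt (fun x : (Fin n → ℝ) × (Fin n → ℝ) => dotL n x.1)
      ((dotL n).comp (ContinuousLinearMap.fst ℝ _ _)) x :=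
    ((dotL n).comp (ContinuousLinearMap.fst ℝ (Fin n → ℝ) (Fin n → ℝ))).hasFDerivAt
  have h2 := ((h1.clm_apply hasFDerivAt_fst).const_mul (1 / 2)).prodMk (h1.clm_apply hasFDerivAt_snd)
  refine h2.congr_fderiv (ContinuousLinearMap.ext fun u => ?_)
  refine Prod.ext ?_ ?_
  · simp [constraintDeriv_apply, dotProduct_comm u.1]
    ring
  · simp [constraintDeriv_apply, dotProduct_comm u.1]
    ring

end Cutoff

namespace Ball

variable {n : ℕ} (b : Ball n)

theorem constraintDeriv_extField {x : (Fin n → ℝ) × (Fin n → ℝ)} (hx : x.1 ≠ 0) :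
    constraintDeriv x (b.extField x) = 0 := by
  rw [constraintDeriv_apply, dotProduct_comm x.2, b.extField_dot_snd hx]
  exact Prod.ext (b.dot_extVelocity hx x.2) rfl

/-- A compactly supported field which has the constraints as first integrals and coincides with
the multiple `c` of the reduced equations in the bounded region `‖x‖ ≤ R`. -/
theorem exists_field (c R : ℝ) :
    ∃ Y : (Fin n → ℝ) × (Fin n → ℝ) → (Fin n → ℝ) × (Fin n → ℝ), ContDiff ℝ 2 Y ∧
      HasCompactSupport Y ∧ (∀ x, constraintDeriv x (Y x) = 0) ∧
      ∀ x ∈ cotangentSphere n, ‖x‖ ≤ R → ∀ᶠ y in nhds x, Y y = c • b.extField y := by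
  obtain ⟨χ, h1, h2, h3, h4⟩ := exists_cutoff n R
  refine ⟨fun x => χ x • c • b.extField x, ?_, h2.smul_right, fun x => ?_, fun x hx hR => ?_⟩
  · refine contDiff_iff_contDiffAt.2 fun x => ?_
    by_cases hx : x ∈ tsupport χ
    · exact h1.contDiffAt.smul ((b.contDiffAt_extField (h3 x hx)).const_smul c)
    · have h5 : ∀ᶠ y in nhds x, χ y • c • b.extField y = 0 := by
        filter_upwards [(isClosed_tsupport χ).isOpen_compl.mem_nhds hx] with y hy
        rw [image_eq_zero_of_notMem_tsupport hy, zero_smul]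
      exact contDiffAt_const.congr_of_eventuallyEq h5
  · simp only
    by_cases hx : x ∈ tsupport χ
    · rw [map_smul, map_smul, b.constraintDeriv_extField (h3 x hx), smul_zero, smul_zero]
    · rw [image_eq_zero_of_notMem_tsupport hx, zero_smul, map_zero]
  · filter_upwards [h4 x hx hR] with y hy
    rw [hy, one_smul]

theorem legendreOpDeriv_smul (γ v : Fin n → ℝ) (c : ℝ) :
    b.legendreOpDeriv γ (c • v) = c • b.legendreOpDeriv γ v := by
  simp [legendreOpDeriv, smul_add]

/-- Along a solution of the reduced equations, the density times the determinant of the solution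
of the variational equation is constant. -/
theorem density_mul_det {c : ℝ} {Y : (Fin n → ℝ) × (Fin n → ℝ) → (Fin n → ℝ) × (Fin n → ℝ)}
    {y : ℝ → (Fin n → ℝ) × (Fin n → ℝ)}
    {A : ℝ → (Fin n → ℝ) × (Fin n → ℝ) →L[ℝ] (Fin n → ℝ) × (Fin n → ℝ)}
    (hyS : ∀ t ∈ Icc (0 : ℝ) 1, y t ∈ cotangentSphere n)
    (hY : ∀ t ∈ Icc (0 : ℝ) 1, ∀ᶠ x in nhds (y t), Y x = c • b.extField x)
    (hy : ∀ t ∈ Icc (0 : ℝ) 1, HasDerivWithinAt y (Y (y t)) (Icc 0 1) t)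
    (hA0 : A 0 = ContinuousLinearMap.id ℝ _)
    (hA : ∀ t ∈ Icc (0 : ℝ) 1,
      HasDerivWithinAt A ((fderiv ℝ Y (y t)).comp (A t)) (Icc 0 1) t) :
    b.density (y 1).1 * LinearMap.det (A 1 : (Fin n → ℝ) × (Fin n → ℝ) →ₗ[ℝ] _)
      = b.density (y 0).1 := by
  set α : ℝ := 1 / (2 * b.ε) - 1 with hα
  let J : ℝ → ℝ := fun t => LinearMap.det (A t : (Fin n → ℝ) × (Fin n → ℝ) →ₗ[ℝ] _)
  let g : ℝ → ℝ := fun t => LinearMap.det (b.legendreOp (y t).1 : (Fin n → ℝ) →ₗ[ℝ] _)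
  have hg0 : ∀ t ∈ Icc (0 : ℝ) 1, 0 < g t := fun t ht =>
    b.det_legendreOp_pos (ne_zero_of_unit (hyS t ht).1)
  have hJ : ∀ t ∈ Icc (0 : ℝ) 1, HasDerivWithinAt J
      (c * ((1 / b.ε - 2) * b.tensorTrace (y t).1 (b.extVelocity (y t).1 (y t).2)) * J t)
      (Icc 0 1) t := fun t ht => by
    have h1 := hasDerivWithinAt_det (hA t ht)
    have h2 : fderiv ℝ Y (y t) = c • fderiv ℝ b.extField (y t) := by
      rw [Filter.EventuallyEq.fderiv_eq (hY t ht)]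
      exact fderiv_const_smul (b.hasFDerivAt_extField
        (ne_zero_of_unit (hyS t ht).1)).differentiableAt c
    have h3 := b.tr_fderiv_extField (hyS t ht)
    have h4 : tr (fderiv ℝ Y (y t)) = c * ((1 / b.ε - 2) *
        b.tensorTrace (y t).1 (b.extVelocity (y t).1 (y t).2)) := by
      rw [h2, tr_smul, h3]
    rw [← h4]
    exact h1
  have hg : ∀ t ∈ Icc (0 : ℝ) 1, HasDerivWithinAt g
      (c * (-2 * b.tensorTrace (y t).1 (b.extVelocity (y t).1 (y t).2)) * g t)
      (Icc 0 1) t := fun t ht => by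
    have h0 := ne_zero_of_unit (hyS t ht).1
    have h1 : HasDerivWithinAt (fun u => (y u).1) (c • b.extVelocity (y t).1 (y t).2)
        (Icc 0 1) t := by
      have := hasDerivWithinAt_clm (ContinuousLinearMap.fst ℝ (Fin n → ℝ) (Fin n → ℝ)) (hy t ht)
      rw [(hY t ht).self_of_nhds] at this
      exact this
    have h2 := b.hasDerivWithinAt_legendreOp h1
    rw [legendreOpDeriv_smul] at h2
    -- Inserting the inverse writes the derivative in the form `D L` that Liouville's formula
    -- requires.
    have h3 : c • b.legendreOpDeriv (y t).1 (b.extVelocity (y t).1 (y t).2)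
        = (c • (b.legendreOpDeriv (y t).1 (b.extVelocity (y t).1 (y t).2)).comp
          (b.legendreInv (y t).1)).comp (b.legendreOp (y t).1) := by
      refine ContinuousLinearMap.ext fun v => ?_
      simp [b.legendreInv_op h0]
    rw [h3] at h2
    have h4 := hasDerivWithinAt_det h2
    have h5 := b.tr_legendreOpDeriv_inv (hyS t ht).1 (b.dot_extVelocity h0 (y t).2)
    have h6 : tr (c • (b.legendreOpDeriv (y t).1 (b.extVelocity (y t).1 (y t).2)).comp
          (b.legendreInv (y t).1)) = c * (-2 * b.tensorTrace (y t).1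
            (b.extVelocity (y t).1 (y t).2)) := by
      rw [tr_smul, h5]
    rw [← h6]
    exact h4
  have hprod : ∀ t ∈ Icc (0 : ℝ) 1, HasDerivWithinAt (fun t => g t ^ α * J t) 0 (Icc 0 1) t :=
    fun t ht => by
      refine (((hg t ht).rpow_const (p := α) (Or.inl (hg0 t ht).ne')).mul (hJ t ht)).congr_deriv ?_
      have h1 : g t ^ (α - 1) * g t = g t ^ α := by
        rw [← Real.rpow_add_one (hg0 t ht).ne', sub_add_cancel]
      have h2 := b.ε_ne
      -- The exponent is determined here by `-2α + 1/ε - 2 = 0`.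
      calc _ = c * b.tensorTrace (y t).1 (b.extVelocity (y t).1 (y t).2) * J t *
            (-2 * α * (g t ^ (α - 1) * g t) + (1 / b.ε - 2) * g t ^ α) := by ring
        _ = 0 := by
          rw [h1, hα]
          field_simp
          ring
  have hconst := constant_of_has_deriv_right_zero (fun t ht => (hprod t ht).continuousWithinAt)
    (fun t ht => (hprod t (Ico_subset_Icc_self ht)).mono_of_mem_nhdsWithin
      (Icc_mem_nhdsGE_of_mem ht)) 1 (by simp)
  have hJ0 : J 0 = 1 := by
    simp only [J, hA0]
    exact LinearMap.det_id
  rw [hJ0, mul_one] at hconst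
  rw [b.density_eq (hyS 1 (by simp)).1, b.density_eq (hyS 0 (by simp)).1]
  exact hconst

/-- For every bounded region there is a diffeomorphism of class `C¹` that coincides with the time
one map of the multiple `c` of the reduced equations along the solutions which stay in this region,
and that preserves the volume form there. -/
theorem exists_localFlow (c R : ℝ) :
    ∃ (Φ : ℝ → (Fin n → ℝ) × (Fin n → ℝ) → (Fin n → ℝ) × (Fin n → ℝ)),
      ContDiff ℝ 1 (Φ 1) ∧ Function.Injective (Φ 1) ∧
      (∀ t ∈ Icc (0 : ℝ) 1, Continuous (Φ t)) ∧
      (∀ t ∈ Icc (0 : ℝ) 1, ∀ x ∈ cotangentSphere n, Φ t x ∈ cotangentSphere n) ∧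
      (∀ y : ℝ → (Fin n → ℝ) × (Fin n → ℝ),
        (∀ t ∈ Icc (0 : ℝ) 1, y t ∈ cotangentSphere n ∧ ‖y t‖ ≤ R ∧
          HasDerivWithinAt y (c • b.field (y t)) (Icc 0 1) t) →
        ∀ t ∈ Icc (0 : ℝ) 1, y t = Φ t (y 0)) ∧
      ∀ x ∈ cotangentSphere n, (∀ t ∈ Icc (0 : ℝ) 1, ‖Φ t x‖ ≤ R) →
        ∀ v : Fin (n - 1) × Fin 2 → (Fin n → ℝ) × (Fin n → ℝ), (∀ a, constraintDeriv x (v a) = 0) →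
          b.density (Φ 1 x).1 * symplPow (n - 1) (fun a => fderiv ℝ (Φ 1) x (v a))
            = b.density x.1 * symplPow (n - 1) v := by
  obtain ⟨Y, hY2, hYc, hYT, hYR⟩ := b.exists_field c R
  obtain ⟨Φ, A, hΦ0, hΦ, hA0, hA, hΦA, hAc⟩ := exists_flow hY2 hYc
  obtain ⟨K, hK⟩ := ContDiff.lipschitzWith_of_hasCompactSupport hYc hY2 two_ne_zero
  have h01 : (1 : ℝ) ∈ Icc (0 : ℝ) 1 := by simp
  -- Conservation at all points of the ambient space allows the identity to be differentiated in
  -- every direction below.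
  have hcons : ∀ t ∈ Icc (0 : ℝ) 1, ∀ x, constraint (Φ t x) = constraint x := fun t ht x => by
    have h1 : ∀ t ∈ Icc (0 : ℝ) 1, HasDerivWithinAt (fun t => constraint (Φ t x)) 0 (Icc 0 1) t :=
      fun t ht => by
        have := (hasFDerivAt_constraint (Φ t x)).comp_hasDerivWithinAt t (hΦ x t ht)
        rw [hYT] at this
        exact this
    have h2 := constant_of_has_deriv_right_zero (fun t ht => (h1 t ht).continuousWithinAt)
      (fun t ht => (h1 t (Ico_subset_Icc_self ht)).mono_of_mem_nhdsWithin
        (Icc_mem_nhdsGE_of_mem ht)) t ht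
    rw [h2, hΦ0]
  have hmem : ∀ t ∈ Icc (0 : ℝ) 1, ∀ x ∈ cotangentSphere n, Φ t x ∈ cotangentSphere n :=
    fun t ht x hx => by rwa [mem_cotangentSphere_iff, hcons t ht, ← mem_cotangentSphere_iff]
  refine ⟨Φ, ?_, fun x x' hxx' => ?_, fun t ht => ?_, hmem, fun y hy t ht => ?_,
    fun x hx hR v hv => ?_⟩
  · refine contDiff_one_iff_hasFDerivAt.2 ⟨A 1, hAc 1 h01, fun x => hΦA x 1 h01⟩
  -- Injectivity is uniqueness backwards in time: two trajectories with a common endpoint are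
  -- compared by Grönwall's inequality after reversal.
  · have hrev : ∀ z, ∀ t ∈ Icc (0 : ℝ) 1, HasDerivWithinAt (fun t => Φ (1 - t) z)
        (-Y (Φ (1 - t) z)) (Icc 0 1) t := fun z t ht => by
      have hm : MapsTo (fun t : ℝ => 1 - t) (Icc 0 1) (Icc 0 1) := fun s hs =>
        ⟨by linarith [hs.2], by linarith [hs.1]⟩
      have h1 := HasDerivWithinAt.scomp (h := fun t : ℝ => 1 - t) t (hΦ z (1 - t) (hm ht))
        ((hasDerivAt_id t).const_sub 1).hasDerivWithinAt hm
      exact h1.congr_deriv (by simp)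
    have h1 := norm_le_of_deriv_le (f := fun t => Φ (1 - t) x - Φ (1 - t) x') (δ := 0) (K := K)
      (ε := 0) le_rfl K.2 le_rfl (fun t ht => (hrev x t ht).sub (hrev x' t ht)) (by simp [hxx'])
      (fun t ht => by
        rw [add_zero, neg_sub_neg, norm_sub_rev]
        exact hK.norm_sub_le _ _) 1 h01
    simpa [hΦ0, sub_eq_zero] using h1
  · exact continuous_iff_continuousAt.2 fun x => (hΦA x t ht).continuousAt
  · have h1 := norm_le_of_deriv_le (f := fun t => y t - Φ t (y 0)) (δ := 0) (K := K)
      (ε := 0) le_rfl K.2 le_rfl (fun t ht => (hy t ht).2.2.sub (hΦ (y 0) t ht)) (by simp [hΦ0])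
      (fun t ht => by
        have h2 : c • b.field (y t) = Y (y t) := by
          rw [(hYR _ (hy t ht).1 (hy t ht).2.1).self_of_nhds, b.extField_eq (hy t ht).1]
        rw [add_zero, h2]
        exact hK.norm_sub_le _ _) t ht
    simpa [sub_eq_zero] using h1
  · have h1 := b.density_mul_det (y := fun t => Φ t x) (A := fun t => A t x)
      (fun t ht => hmem t ht x hx) (fun t ht => hYR _ (hmem t ht x hx) (hR t ht)) (hΦ x) (hA0 x)
      (hA x)
    simp only [hΦ0] at h1
    have h2 : fderiv ℝ (Φ 1) x = A 1 x := (hΦA x 1 h01).fderiv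
    have h3 : (constraintDeriv (Φ 1 x)).comp (A 1 x) = constraintDeriv x := by
      have h4 := (hasFDerivAt_constraint (Φ 1 x)).comp x (hΦA x 1 h01)
      have h5 : constraint ∘ Φ 1 = (constraint : (Fin n → ℝ) × (Fin n → ℝ) → ℝ × ℝ) :=
        funext fun z => hcons 1 h01 z
      rw [h5] at h4
      exact h4.unique (hasFDerivAt_constraint x)
    have h6 : symplPow (n - 1) (fun a => A 1 x (v a)) = LinearMap.det (A 1 x).toLinearMap
        * symplPow (n - 1) v :=
      symplPow_comp hx (hmem 1 h01 x hx) (A := (A 1 x).toLinearMap)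
        (fun u => DFunLike.congr_fun h3 u) hv
    rw [h2, h6, ← h1, mul_assoc]

end Ball

/-! ### Invariance of the measure -/

variable {n : ℕ}

/-- Patches take values in the cotangent bundle, so their derivatives are tangent to it. -/
theorem Patch.constraintDeriv_fderiv (P : Patch n) {u : Fin (n - 1) × Fin 2 → ℝ} (hu : u ∈ P.dom)
    (e : Fin (n - 1) × Fin 2 → ℝ) : constraintDeriv (P.toFun u) (fderiv ℝ P.toFun u e) = 0 := by
  have h1 : HasFDerivAt P.toFun (fderiv ℝ P.toFun u) u :=
    ((P.contDiffOn.contDiffAt (P.isOpen_dom.mem_nhds hu)).differentiableAt one_ne_zero).hasFDerivAt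
  have h2 := (hasFDerivAt_constraint (P.toFun u)).comp u h1
  have h3 : constraint ∘ P.toFun =ᶠ[nhds u] fun _ => (1 / 2, 0) := by
    filter_upwards [P.isOpen_dom.mem_nhds hu] with w hw
    exact (mem_cotangentSphere_iff _).1 (P.mapsTo hw)
  exact DFunLike.congr_fun (h2.unique ((hasFDerivAt_const _ u).congr_of_eventuallyEq h3)) e

theorem Patch.measurableSet_inter_preimage (P : Patch n) {A : Set (Fin (n - 1) × Fin 2 → ℝ)}
    (hA : MeasurableSet A) (hAP : A ⊆ P.dom) {G : Set ((Fin n → ℝ) × (Fin n → ℝ))}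
    (hG : MeasurableSet G) : MeasurableSet (A ∩ P.toFun ⁻¹' G) := by
  have h := ((P.contDiffOn.continuousOn.mono hAP).domRestrict.measurable hG)
  have h2 := (MeasurableEmbedding.subtype_coe hA).measurableSet_image.2 h
  convert h2 using 1
  ext u
  simp [and_comm]

/-- The composition of a patch with a map of class `C¹` which preserves the cotangent bundle. -/
def Patch.comp (P : Patch n) {Ψ : (Fin n → ℝ) × (Fin n → ℝ) → (Fin n → ℝ) × (Fin n → ℝ)}
    (hΨ : ContDiff ℝ 1 Ψ) (hS : ∀ x ∈ cotangentSphere n, Ψ x ∈ cotangentSphere n) : Patch n where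
  toFun := Ψ ∘ P.toFun
  dom := P.dom
  isOpen_dom := P.isOpen_dom
  contDiffOn := hΨ.comp_contDiffOn P.contDiffOn
  mapsTo := fun _ hu => hS _ (P.mapsTo hu)

/-- A map of class `C¹` that preserves the volume form on `G` does not increase the masses. -/
theorem patchMass_image_le {f : (Fin n → ℝ) → ℝ}
    {Ψ : (Fin n → ℝ) × (Fin n → ℝ) → (Fin n → ℝ) × (Fin n → ℝ)} (hΨ : ContDiff ℝ 1 Ψ)
    {G : Set ((Fin n → ℝ) × (Fin n → ℝ))} (hG : MeasurableSet G)
    (hΨG : ∀ x ∈ cotangentSphere n, x ∈ G →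
      ∀ v : Fin (n - 1) × Fin 2 → (Fin n → ℝ) × (Fin n → ℝ), (∀ a, constraintDeriv x (v a) = 0) →
        f (Ψ x).1 * symplPow (n - 1) (fun a => fderiv ℝ Ψ x (v a)) = f x.1 * symplPow (n - 1) v)
    {ψ : cotangentSphere n → cotangentSphere n} (hψ : ∀ x, (ψ x).1 = Ψ x.1)
    (hS : ∀ x ∈ cotangentSphere n, Ψ x ∈ cotangentSphere n)
    (S : Set (cotangentSphere n)) :
    patchMass f (ψ '' (S ∩ Subtype.val ⁻¹' G)) ≤ patchMass f S := by
  conv_rhs => unfold patchMass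
  refine le_iInf fun P => le_iInf fun A => le_iInf fun hA => le_iInf fun hAP => le_iInf fun hSA => ?_
  have hA' := P.measurableSet_inter_preimage hA hAP hG
  refine iInf_le_of_le (P.comp hΨ hS) (iInf_le_of_le _ (iInf_le_of_le hA' (iInf_le_of_le
      (inter_subset_left.trans hAP) (iInf_le_of_le ?_ ?_))))
  · rintro _ ⟨_, ⟨x, ⟨hx, hxG⟩, rfl⟩, rfl⟩
    obtain ⟨u, hu, hux⟩ := hSA ⟨x, hx, rfl⟩
    refine ⟨u, ⟨hu, ?_⟩, ?_⟩
    · rw [mem_preimage, hux]; exact hxG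
    · rw [hψ, ← hux]; rfl
  · refine le_trans (le_of_eq ?_) (lintegral_mono_set (inter_subset_left (t := P.toFun ⁻¹' G)))
    refine setLIntegral_congr_fun hA' fun u hu => ?_
    have hud := hAP hu.1
    have h1 : fderiv ℝ (P.comp hΨ hS).toFun u
        = (fderiv ℝ Ψ (P.toFun u)).comp (fderiv ℝ P.toFun u) :=
      fderiv_comp u (hΨ.differentiable one_ne_zero _)
        ((P.contDiffOn.contDiffAt (P.isOpen_dom.mem_nhds hud)).differentiableAt one_ne_zero)
    have h2 := hΨG _ (P.mapsTo hud) hu.2 (fun a => fderiv ℝ P.toFun u (Pi.single a 1))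
      (fun a => P.constraintDeriv_fderiv hud _)
    simp only [h1, ContinuousLinearMap.comp_apply]
    rw [← h2]
    rfl

/-- Countable covers are transported piece by piece. The measure is given by the outer measure only
on Borel sets; the image is Borel because it is a continuous injective image in a Polish space. -/
theorem formMeasure_image_le {f : (Fin n → ℝ) → ℝ}
    {Ψ : (Fin n → ℝ) × (Fin n → ℝ) → (Fin n → ℝ) × (Fin n → ℝ)} (hΨ : ContDiff ℝ 1 Ψ)
    {G : Set ((Fin n → ℝ) × (Fin n → ℝ))} (hG : MeasurableSet G)
    (hΨG : ∀ x ∈ cotangentSphere n, x ∈ G →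
      ∀ v : Fin (n - 1) × Fin 2 → (Fin n → ℝ) × (Fin n → ℝ), (∀ a, constraintDeriv x (v a) = 0) →
        f (Ψ x).1 * symplPow (n - 1) (fun a => fderiv ℝ Ψ x (v a)) = f x.1 * symplPow (n - 1) v)
    {ψ : cotangentSphere n → cotangentSphere n} (hψ : ∀ x, (ψ x).1 = Ψ x.1)
    (hinj : Function.Injective Ψ) {B : Set (cotangentSphere n)}
    (hB : MeasurableSet B) :
    formMeasure f (ψ '' (B ∩ Subtype.val ⁻¹' G)) ≤ formMeasure f B := by
  have hS : ∀ x ∈ cotangentSphere n, Ψ x ∈ cotangentSphere n := fun x hx => by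
    rw [← hψ ⟨x, hx⟩]; exact (ψ ⟨x, hx⟩).2
  have hψc : Continuous ψ := by
    refine continuous_induced_rng.2 ?_
    rw [show Subtype.val ∘ ψ = Ψ ∘ Subtype.val from funext hψ]
    exact hΨ.continuous.comp continuous_subtype_val
  have hψi : Function.Injective ψ := fun x y hxy =>
    Subtype.ext (hinj (by rw [← hψ, ← hψ, hxy]))
  have : PolishSpace (cotangentSphere n) := isClosed_cotangentSphere.polishSpace
  have hm : MeasurableSet (ψ '' (B ∩ Subtype.val ⁻¹' G)) :=
    (hB.inter (measurable_subtype_coe hG)).image_of_continuousOn_injOn hψc.continuousOn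
      hψi.injOn
  rw [formMeasure, toMeasure_apply _ _ hm, toMeasure_apply _ _ hB, OuterMeasure.ofFunction_apply,
    OuterMeasure.ofFunction_apply]
  refine le_iInf fun t => le_iInf fun ht => ?_
  refine iInf_le_of_le (fun i => ψ '' (t i ∩ Subtype.val ⁻¹' G)) (iInf_le_of_le ?_ ?_)
  · rw [← image_iUnion, ← iUnion_inter]
    exact image_mono (inter_subset_inter_left _ ht)
  · exact ENNReal.tsum_le_tsum fun i => patchMass_image_le hΨ hG hΨG hψ hS (t i)

namespace Ball

variable (b : Ball n)

/-- If every point of `C` is the end of a solution that starts in `B`, then the measure of `C` is at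
most that of `B`. -/
theorem formMeasure_le_of_measurable (c : ℝ) {B C : Set (cotangentSphere n)} (hB : MeasurableSet B)
    (h : ∀ z ∈ C, ∃ y : ℝ → cotangentSphere n, y 0 ∈ B ∧ y 1 = z ∧ ∀ t ∈ Icc (0 : ℝ) 1,
      HasDerivWithinAt (fun t => (y t).1) (c • b.field (y t).1) (Icc 0 1) t) :
    formMeasure b.density C ≤ formMeasure b.density B := by
  -- The endpoints are sorted by a bound on the whole trajectory. Continuity of the measure along an
  -- increasing union needs no measurability of these sets.
  let D : ℕ → Set (cotangentSphere n) := fun R => {z | ∃ y : ℝ → cotangentSphere n, y 0 ∈ B ∧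
    y 1 = z ∧ ∀ t ∈ Icc (0 : ℝ) 1, ‖(y t).1‖ ≤ R ∧
      HasDerivWithinAt (fun t => (y t).1) (c • b.field (y t).1) (Icc 0 1) t}
  have hmono : Monotone D := fun R R' hR z ⟨y, h0, h1, hy⟩ =>
    ⟨y, h0, h1, fun t ht => ⟨(hy t ht).1.trans (by exact_mod_cast hR), (hy t ht).2⟩⟩
  have hCD : C ⊆ ⋃ R, D R := fun z hz => by
    obtain ⟨y, h0, h1, hy⟩ := h z hz
    obtain ⟨M, hM⟩ := isCompact_Icc.exists_bound_of_continuousOn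
      (fun t ht => (hy t ht).continuousWithinAt)
    obtain ⟨R, hR⟩ := exists_nat_ge M
    exact mem_iUnion.2 ⟨R, y, h0, h1, fun t ht => ⟨(hM t ht).trans hR, hy t ht⟩⟩
  refine (measure_mono hCD).trans ?_
  rw [hmono.measure_iUnion]
  refine iSup_le fun R => ?_
  obtain ⟨Φ, hΦ1, hΦi, hΦc, hΦS, hΦy, hΦf⟩ := b.exists_localFlow c R
  -- These are the starting points whose truncated trajectory stays where the truncated field is the
  -- true one.
  let G : Set ((Fin n → ℝ) × (Fin n → ℝ)) := {x | ∀ t ∈ Icc (0 : ℝ) 1, ‖Φ t x‖ ≤ R}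
  have hG : IsClosed G := by
    have : G = ⋂ t ∈ Icc (0 : ℝ) 1, {x | ‖Φ t x‖ ≤ R} := by
      ext x; simp [G]
    rw [this]
    exact isClosed_biInter fun t ht => isClosed_le (hΦc t ht).norm continuous_const
  let ψ : cotangentSphere n → cotangentSphere n := fun x => ⟨Φ 1 x.1, hΦS 1 (by simp) x.1 x.2⟩
  refine (measure_mono ?_).trans (formMeasure_image_le (f := b.density) (ψ := ψ) hΦ1
    hG.measurableSet (fun x hx hxG => hΦf x hx hxG) (fun _ => rfl) hΦi hB)
  rintro z ⟨y, h0, h1, hy⟩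
  have h2 := hΦy (fun t => (y t).1) fun t ht => ⟨(y t).2, hy t ht⟩
  refine ⟨y 0, ⟨h0, fun t ht => ?_⟩, Subtype.ext ?_⟩
  · rw [← h2 t ht]
    exact (hy t ht).1
  · rw [← h1]
    exact (h2 1 (by simp)).symm

/-- Passing to a measurable hull of `B` removes the measurability assumption. This matters for the
reversed flow, whose starting set is an image not known to be Borel. -/
theorem formMeasure_le (c : ℝ) {B C : Set (cotangentSphere n)}
    (h : ∀ z ∈ C, ∃ y : ℝ → cotangentSphere n, y 0 ∈ B ∧ y 1 = z ∧ ∀ t ∈ Icc (0 : ℝ) 1,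
      HasDerivWithinAt (fun t => (y t).1) (c • b.field (y t).1) (Icc 0 1) t) :
    formMeasure b.density C ≤ formMeasure b.density B := by
  rw [← measure_toMeasurable B]
  refine b.formMeasure_le_of_measurable c (measurableSet_toMeasurable _ _) fun z hz => ?_
  obtain ⟨y, h0, h1⟩ := h z hz
  exact ⟨y, subset_toMeasurable _ _ h0, h1⟩

/-- Reparametrization of a solution by an affine map of the unit interval. -/
theorem hasDerivWithinAt_reparam {T a c : ℝ} {y : ℝ → cotangentSphere n}
    (hy : IsIntegralCurveOn (fun t => (y t : (Fin n → ℝ) × (Fin n → ℝ))) (fun _ => b.field)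
      (uIcc 0 T)) (hm : ∀ s ∈ Icc (0 : ℝ) 1, a + s * c ∈ uIcc 0 T) :
    ∀ s ∈ Icc (0 : ℝ) 1, HasDerivWithinAt (fun s => (y (a + s * c)).1)
      (c • b.field (y (a + s * c)).1) (Icc 0 1) s := fun s hs =>
  HasDerivWithinAt.scomp (h := fun s : ℝ => a + s * c) s (hy (a + s * c) (hm s hs))
    (((hasDerivAt_mul_const c).const_add a).hasDerivWithinAt) hm

end Ball

end RubberRolling

/-- The measure `(det 𝐈|_{𝔳_γ})^{1/(2ε)-1} w^{n-1}` on `T*S^{n-1}` is invariant: if, for every point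
`x` of a Borel set `B`, the curve `t ↦ φ t x` in `T*S^{n-1}` is the solution of the reduced equations
with the initial condition `x` on the time interval between `0` and `T`, then the image of `B` under
the time `T` map has the same measure as `B`. -/
theorem theorem4p5 {n : ℕ} (b : RubberRolling.Ball n) (T : ℝ)
    (B : Set (RubberRolling.cotangentSphere n)) (hB : MeasurableSet B)
    (φ : ℝ → RubberRolling.cotangentSphere n → RubberRolling.cotangentSphere n)
    (hφ_init : ∀ x ∈ B, φ 0 x = x)
    (hφ : ∀ x ∈ B, IsIntegralCurveOn
      (fun t => (φ t x : (Fin n → ℝ) × (Fin n → ℝ))) (fun _ => b.field) (Set.uIcc 0 T)) :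
    RubberRolling.formMeasure b.density (φ T '' B) = RubberRolling.formMeasure b.density B := by
  have hm : ∀ s ∈ Icc (0 : ℝ) 1, 0 + s * T ∈ uIcc 0 T := fun s hs => by
    rw [zero_add, mem_uIcc]
    rcases le_total 0 T with hT | hT
    · exact Or.inl ⟨mul_nonneg hs.1 hT, mul_le_of_le_one_left hT hs.2⟩
    · exact Or.inr ⟨by nlinarith [hs.2], mul_nonpos_of_nonneg_of_nonpos hs.1 hT⟩
  have hm' : ∀ s ∈ Icc (0 : ℝ) 1, T + s * -T ∈ uIcc 0 T := fun s hs => by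
    have h := hm (1 - s) ⟨by linarith [hs.2], by linarith [hs.1]⟩
    convert h using 1
    ring
  -- Time is rescaled to the unit interval, which multiplies the field by `T`, or by `-T` when the
  -- solutions are traversed backwards from the image to `B`.
  refine le_antisymm (b.formMeasure_le T ?_) (b.formMeasure_le (-T) fun x hx => ?_)
  · rintro _ ⟨x, hx, rfl⟩
    exact ⟨fun s => φ (0 + s * T) x, by simpa [hφ_init x hx] using hx, by simp,
      b.hasDerivWithinAt_reparam (y := fun t => φ t x) (hφ x hx) hm⟩
  · exact ⟨fun s => φ (T + s * -T) x, ⟨x, hx, by simp⟩, by simp [hφ_init x hx],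
      b.hasDerivWithinAt_reparam (y := fun t => φ t x) (hφ x hx) hm'⟩
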